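/- For $f\in L^2((0,1);\mathbb{C})$ and $n\in\mathbb{N}=\{1,2,\dots\}$ let $\hat f(n)=\sqrt2\int_0^1 f(x)\sin(n\pi x)\,\mathrm{d}x$. For $\alpha\ge 0$ let $\mathrm{H}^\alpha=\mathrm{H}^\alpha(0,1)$ be the space of all $f\in L^2((0,1);\mathbb{C})$ with $\sum_{n\ge1} n^{2\alpha}|\hat f(n)|^2<\infty$, with norm $\|f\|_\alpha=\big(\sum_{n\ge1} n^{2\alpha}|\hat f(n)|^2\big)^{1/2}$. For a modulus $\mu\in(0,1)$ put $w_\mu(z)=\int_0^z(1-t^2)^{-1/2}(1-\mu^2t^2)^{-1/2}\,\mathrm{d}t$ for $z\in[-1,1]$ and $K(\mu)=w_\mu(1)$. Let $\operatorname{sn}(\cdot,\mu):\mathbb{R}\to[-1,1]$ be the $4K(\mu)$-periodic function which on $[-K(\mu),K(\mu)]$ is the inverse of $w_\mu$ and satisfies $\operatorname{sn}(2K(\mu)-y,\mu)=\operatorname{sn}(y,\mu)$. The nome of $\mu$ is $q=\exp\big[-\pi K(\sqrt{1-\mu^2})/K(\mu)\big]\in(0,1)$. For $n\in\mathbb{N}$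 let $$u_n(x,\mu)=2^{3/2}\,n\,\mu\,K(\mu)\operatorname{sn}\big(2K(\mu)nx,\mu\big),\qquad \eta_n(\mu)=4n^2(1+\mu^2)K(\mu)^2 .$$ For $\alpha\ge0$ and $q\in(0,1)$ let $$s_\alpha(q)=\sum_{l=0}^\infty(2l+1)^\alpha\frac{(1-q)q^l}{1-q^{2l+1}} .$$ **Theorem.** Let $\alpha\ge 0$. The equation $s_\alpha(q)=2$ has a unique solution $q=r_0(\alpha)$ in $(0,1)$. Let $\{q_n\}_{n=1}^\infty\subset(0,1)$ satisfy $\sup_n q_n<r_0(\alpha)$, and let $\{\mu_n\}_{n=1}^\infty\subset(0,1)$ be moduli such that $\mu_n$ has nome $q_n$ for every $n$. Then each $u_n(\cdot,\mu_n)$ is an eigenfunction of the Gross–Pitaevskii problem with eigenvalue $\eta=\eta_n(\mu_n)$, that is, a nonzero solution, twice continuously differentiable on $[0,1]$, of $$u''-u^3+\eta u=0,\qquad u(0)=u(1)=0,$$ and the set $\{u_n(\cdot,\mu_n)\}_{n=1}^\infty$ is a basis of $\mathrm{H}^\alpha$: these functions belong to $\mathrm{H}^\alpha$ and form an unconditional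 Schauder basis of it (a Schauder basis in every ordering). -/

import Mathlib

open MeasureTheory Set

noncomputable section

namespace GrossPitaevskii

/-! ### Sine-Fourier coefficients and the Sobolev scale on the interval `(0,1)` -/

/-- The space `L²((0,1); ℂ)`. -/
abbrev L2I : Type := Lp ℂ 2 (volume.restrict (Ioo (0 : ℝ) 1))

/-- The `n`-th sine-Fourier coefficient `√2 ∫₀¹ f(x) sin(nπx) dx`. -/
def sineCoeff (f : L2I) (n : ℕ+) : ℂ :=
  (√2 : ℂ) * ∫ x in Ioo (0 : ℝ) 1, f x * (Real.sin ((n : ℝ) * Real.pi * x) : ℂ)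

theorem integrable_mul_sin (f : L2I) (n : ℕ+) :
    Integrable (fun x : ℝ => f x * (Real.sin ((n : ℝ) * Real.pi * x) : ℂ))
      (volume.restrict (Ioo (0 : ℝ) 1)) := by
  have hf : Integrable (f : ℝ → ℂ) (volume.restrict (Ioo (0 : ℝ) 1)) :=
    (Lp.memLp f).integrable (by norm_num)
  refine hf.mul_bdd (c := 1) ?_ ?_
  · exact Continuous.aestronglyMeasurable (by fun_prop)
  · refine Filter.Eventually.of_forall fun x => ?_
    rw [Complex.norm_real]
    exact Real.abs_sin_le_one _

theorem sineCoeff_add (f g : L2I) (n : ℕ+) :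
    sineCoeff (f + g) n = sineCoeff f n + sineCoeff g n := by
  unfold sineCoeff
  rw [← mul_add, ← integral_add (integrable_mul_sin f n) (integrable_mul_sin g n)]
  congr 1
  refine integral_congr_ae ?_
  filter_upwards [Lp.coeFn_add f g] with x hx
  rw [hx, Pi.add_apply, add_mul]

theorem sineCoeff_smul (c : ℂ) (f : L2I) (n : ℕ+) :
    sineCoeff (c • f) n = c * sineCoeff f n := by
  unfold sineCoeff
  rw [mul_left_comm, ← integral_const_mul c]
  congr 1
  refine integral_congr_ae ?_
  filter_upwards [Lp.coeFn_smul c f] with x hx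
  rw [hx, Pi.smul_apply, smul_eq_mul, mul_assoc]

open AddCircle in
theorem ae_eq_zero_of_sine_orthogonal (f : ℝ → ℂ) (hf : MemLp f 2 (volume.restrict (Ioo (0:ℝ) 1)))
  (h : ∀ n : ℕ+, ∫ x in Ioo (0 : ℝ) 1, f x * (Real.sin ((n : ℝ) * Real.pi * x) : ℂ) = 0) :
  f =ᵐ[volume.restrict (Ioo (0:ℝ) 1)] 0 := by
  set f₀ : ℝ → ℂ := (Ioo (0:ℝ) 1).indicator f with hf₀
  have hm : MemLp f₀ 2 volume := (memLp_indicator_iff_restrict measurableSet_Ioo).2 hf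
  have hm' : MemLp (fun x => f₀ (-x)) 2 volume :=
    hm.comp_measurePreserving (Measure.measurePreserving_neg volume)
  set F : ℝ → ℂ := fun x => f₀ x - f₀ (-x) with hF
  have hFm : MemLp F 2 volume := hm.sub hm'
  have hz : ∀ n : ℤ, ∫ x in Ioo (0 : ℝ) 1, f x * (Real.sin ((n : ℝ) * Real.pi * x) : ℂ) = 0 := by
    intro n
    rcases lt_trichotomy n 0 with hn | rfl | hn
    · have := h ⟨n.natAbs, by omega⟩
      have e : ((n.natAbs : ℕ) : ℝ) = -(n:ℝ) := by
        rw [Nat.cast_natAbs, abs_of_neg hn]; push_cast; rfl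
      simp only [PNat.mk_coe, e, neg_mul, Real.sin_neg, Complex.ofReal_neg, mul_neg, integral_neg,
        neg_eq_zero] at this
      exact this
    · simp
    · have := h ⟨n.natAbs, by omega⟩
      have e : ((n.natAbs : ℕ) : ℝ) = (n:ℝ) := by
        rw [Nat.cast_natAbs, abs_of_pos hn]
      simp only [PNat.mk_coe, e] at this
      exact this
  have hsupp : ∀ x, x ∉ Ioc (-1:ℝ) 1 → F x = 0 := by
    intro x hx
    have h1 : x ∉ Ioo (0:ℝ) 1 := fun h => hx ⟨by linarith [h.1], h.2.le⟩
    have h2 : -x ∉ Ioo (0:ℝ) 1 := fun h => hx ⟨by linarith [h.2], by linarith [h.1]⟩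
    simp [hF, hf₀, h1, h2]
  have hc : ∀ n : ℤ, fourierCoeffOn (show (-1:ℝ) < 1 by norm_num) F n = 0 := by
    intro n
    rw [fourierCoeffOn_eq_integral, smul_eq_zero]
    right
    rw [intervalIntegral.integral_of_le (by norm_num),
      setIntegral_eq_integral_of_forall_compl_eq_zero (fun x hx => by rw [hsupp x hx, smul_zero])]
    set E : ℝ → ℂ := fun x => fourier (-n) (x : AddCircle ((1:ℝ) - -1)) with hE
    have hEf : ∀ x, E x = Complex.exp (-(n * Real.pi * x * Complex.I)) := by
      intro x
      simp only [hE, fourier_coe_apply]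
      congr 1
      push_cast
      ring
    have hEc : Continuous E := by
      rw [funext hEf]; fun_prop
    have hEn : ∀ x, ‖E x‖ ≤ 1 := by
      intro x
      rw [hEf, show -(n * Real.pi * x * Complex.I : ℂ) = ((-(n * Real.pi * x) : ℝ) : ℂ) * Complex.I by
        push_cast; ring, Complex.norm_exp_ofReal_mul_I]
    have hi : Integrable f₀ volume :=
      (integrable_indicator_iff measurableSet_Ioo).2 (hf.integrable (by norm_num))
    have i1 : Integrable (fun x => E x * f₀ x) :=
      hi.bdd_mul (c := 1) hEc.aestronglyMeasurable (Filter.Eventually.of_forall hEn)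
    have i2 : Integrable (fun x => E (-x) * f₀ x) :=
      hi.bdd_mul (c := 1) (hEc.comp continuous_neg).aestronglyMeasurable
        (Filter.Eventually.of_forall fun x => hEn (-x))
    have i3 : Integrable (fun x => E x * f₀ (-x)) := by
      simpa using i2.comp_neg
    have e1 : ∫ x, E x * f₀ (-x) = ∫ x, E (-x) * f₀ x := by
      rw [← integral_neg_eq_self (fun x => E x * f₀ (-x))]
      simp
    change ∫ x, E x * (f₀ x - f₀ (-x)) = 0
    simp only [mul_sub]
    rw [integral_sub i1 i3, e1, ← integral_sub i1 i2]
    have e2 : ∀ x, E x * f₀ x - E (-x) * f₀ x = (Ioo (0:ℝ) 1).indicator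
        (fun x => (-2 * Complex.I) * (f x * (Real.sin ((n : ℝ) * Real.pi * x) : ℂ))) x := by
      intro x
      by_cases hx : x ∈ Ioo (0:ℝ) 1
      · simp only [hf₀, indicator_of_mem hx, hEf]
        push_cast
        rw [Complex.sin]
        have : -((n:ℂ) * Real.pi * -x * Complex.I) = n * Real.pi * x * Complex.I := by ring
        rw [this, ← neg_mul (n * Real.pi * x : ℂ)]
        ring_nf
        simp only [Complex.I_sq]
        ring
      · simp [hf₀, indicator_of_notMem hx]
    rw [integral_congr_ae (Filter.Eventually.of_forall e2), integral_indicator measurableSet_Ioo,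
      integral_const_mul, hz, mul_zero]
  have hs := hasSum_sq_fourierCoeffOn (show (-1:ℝ) < 1 by norm_num) (hFm.restrict (Ioc (-1) 1))
  have h0 : ∫ x in (-1:ℝ)..1, ‖F x‖ ^ 2 = 0 := by
    simp only [hc, norm_zero, ne_eq, OfNat.ofNat_ne_zero, not_false_eq_true, zero_pow] at hs
    rcases smul_eq_zero.1 (hs.unique hasSum_zero) with h | h
    · norm_num at h
    · exact h
  rw [intervalIntegral.integral_of_le (by norm_num), setIntegral_eq_zero_iff_of_nonneg_ae
    (Filter.Eventually.of_forall fun x => by positivity)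
    ((memLp_two_iff_integrable_sq_norm hFm.1).1 hFm).integrableOn] at h0
  have h1 := ae_restrict_of_ae_restrict_of_subset
    (show Ioo (0:ℝ) 1 ⊆ Ioc (-1) 1 from fun x hx => ⟨by linarith [hx.1], hx.2.le⟩) h0
  filter_upwards [h1, ae_restrict_mem measurableSet_Ioo] with x hx hx'
  have h2 : -x ∉ Ioo (0:ℝ) 1 := fun h => by linarith [h.1, hx'.1]
  have : F x = f x := by simp [hF, hf₀, indicator_of_mem hx', indicator_of_notMem h2]
  rw [← this]
  simpa using hx

/-- Completeness of the sine system: it makes the Sobolev norms below definite. -/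
theorem eq_zero_of_sineCoeff_eq_zero (f : L2I) (hf : ∀ n, sineCoeff f n = 0) : f = 0 := by
  rw [Lp.eq_zero_iff_ae_eq_zero]
  refine ae_eq_zero_of_sine_orthogonal f (Lp.memLp f) fun n => ?_
  have h2 : (√2 : ℂ) ≠ 0 := by simp
  exact (mul_eq_zero.1 (hf n)).resolve_left h2

theorem norm_sq_weighted (α : ℝ) (n : ℕ+) (z : ℂ) :
    ‖(((n : ℝ) ^ α : ℝ) : ℂ) * z‖ ^ 2 = (n : ℝ) ^ (2 * α) * ‖z‖ ^ 2 := by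
  have hn : (0 : ℝ) ≤ (n : ℝ) := by positivity
  rw [norm_mul, Complex.norm_real, Real.norm_of_nonneg (Real.rpow_nonneg hn α), mul_pow,
    ← Real.rpow_natCast, ← Real.rpow_mul hn]
  congr 2
  push_cast
  ring

theorem memlp_iff_summable (α : ℝ) (f : L2I) :
    Memℓp (fun n : ℕ+ => (((n : ℝ) ^ α : ℝ) : ℂ) * sineCoeff f n) 2 ↔
      Summable fun n : ℕ+ => (n : ℝ) ^ (2 * α) * ‖sineCoeff f n‖ ^ 2 := by
  rw [memℓp_gen_iff (by norm_num)]
  refine summable_congr fun n => ?_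
  rw [← norm_sq_weighted]
  norm_num

/-- The functions `f ∈ L²(0,1)` with `∑ n^{2α} |f̂(n)|² < ∞`. -/
def sobolevSubmodule (α : ℝ) : Submodule ℂ L2I where
  carrier := {f | Summable fun n : ℕ+ => (n : ℝ) ^ (2 * α) * ‖sineCoeff f n‖ ^ 2}
  zero_mem' := by
    have h : ∀ n, sineCoeff 0 n = 0 := fun n => by
      simpa using sineCoeff_smul 0 0 n
    simp [h, summable_zero]
  add_mem' := by
    intro f g hf hg
    simp only [mem_ofPred_eq, ← memlp_iff_summable] at hf hg ⊢
    convert hf.add hg using 1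
    funext n
    simp only [Pi.add_apply, sineCoeff_add, mul_add]
  smul_mem' := by
    intro c f hf
    simp only [mem_ofPred_eq, ← memlp_iff_summable] at hf ⊢
    convert hf.const_smul c using 1
    funext n
    simp only [Pi.smul_apply, sineCoeff_smul, smul_eq_mul]
    ring

/-- The Sobolev space `H^α = H^α(0,1)`; its norm is `(∑ n^{2α} |f̂(n)|²)^{1/2}`, see
`SobolevH.norm_eq` (not the one inherited from `L²`, hence the type synonym). -/
def SobolevH (α : ℝ) : Type := sobolevSubmodule α

namespace SobolevH

instance (α : ℝ) : AddCommGroup (SobolevH α) :=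
  inferInstanceAs (AddCommGroup (sobolevSubmodule α))

instance (α : ℝ) : Module ℂ (SobolevH α) :=
  inferInstanceAs (Module ℂ (sobolevSubmodule α))

/-- The element of `L²(0,1)` underlying an element of `H^α`. -/
def toL2 {α : ℝ} (f : SobolevH α) : L2I := Subtype.val f

/-- The linear map `f ↦ (n^α f̂(n))ₙ` from `H^α` to `ℓ²`. -/
def toEll2 (α : ℝ) : SobolevH α →ₗ[ℂ] lp (fun _ : ℕ+ => ℂ) 2 where
  toFun f := ⟨fun n => (((n : ℝ) ^ α : ℝ) : ℂ) * sineCoeff f.toL2 n,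
    (memlp_iff_summable α f.toL2).2 (Subtype.property f)⟩
  map_add' f g := by
    ext n
    exact (congrArg _ (sineCoeff_add f.toL2 g.toL2 n)).trans (mul_add _ _ _)
  map_smul' c f := by
    ext n
    exact (congrArg _ (sineCoeff_smul c f.toL2 n)).trans (mul_left_comm _ _ _)

theorem toEll2_injective (α : ℝ) : Function.Injective (toEll2 α) := by
  rw [injective_iff_map_eq_zero]
  intro f hf
  refine Subtype.ext (eq_zero_of_sineCoeff_eq_zero f.toL2 fun n => ?_)
  have h : (((n : ℝ) ^ α : ℝ) : ℂ) * sineCoeff f.toL2 n = 0 := congrArg (fun v => v.1 n) hf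
  rcases mul_eq_zero.1 h with h | h
  · have hn : (0 : ℝ) < (n : ℝ) ^ α := Real.rpow_pos_of_pos (by exact_mod_cast n.pos) α
    exact absurd (Complex.ofReal_eq_zero.1 h) hn.ne'
  · exact h

instance (α : ℝ) : NormedAddCommGroup (SobolevH α) :=
  NormedAddCommGroup.induced (SobolevH α) (lp (fun _ : ℕ+ => ℂ) 2) (toEll2 α)
    (toEll2_injective α)

instance (α : ℝ) : NormedSpace ℂ (SobolevH α) :=
  NormedSpace.induced ℂ (SobolevH α) (lp (fun _ : ℕ+ => ℂ) 2) (toEll2 α)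

theorem norm_eq {α : ℝ} (f : SobolevH α) :
    ‖f‖ = √(∑' n : ℕ+, (n : ℝ) ^ (2 * α) * ‖sineCoeff f.toL2 n‖ ^ 2) := by
  have h : ‖toEll2 α f‖ ^ (2 : ℝ) = ∑' n : ℕ+, ‖toEll2 α f n‖ ^ (2 : ℝ) := by
    simpa using lp.norm_rpow_eq_tsum (p := 2) (by norm_num) (toEll2 α f)
  have h' : ∀ n, ‖toEll2 α f n‖ ^ (2 : ℝ) = (n : ℝ) ^ (2 * α) * ‖sineCoeff f.toL2 n‖ ^ 2 :=
    fun n => by rw [← norm_sq_weighted, Real.rpow_two]; rfl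
  rw [tsum_congr h', Real.rpow_two] at h
  rw [← h, Real.sqrt_sq (norm_nonneg _)]
  rfl

end SobolevH

/-! ### The Jacobi elliptic sine and the nome -/

/-- `w(z) = ∫₀ᶻ (1-t²)^{-1/2} (1-μ²t²)^{-1/2} dt`, used for `z ∈ [-1,1]` and modulus
`μ ∈ (0,1)`. -/
def ellipticW (μ z : ℝ) : ℝ :=
  ∫ t in (0 : ℝ)..z, (1 - t ^ 2) ^ (-(1 / 2) : ℝ) * (1 - μ ^ 2 * t ^ 2) ^ (-(1 / 2) : ℝ)

/-- The complete elliptic integral of the first kind. -/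
def ellipticK (μ : ℝ) : ℝ := ellipticW μ 1

/-- The inverse of the increasing odd bijection `w : [-1,1] → [-K(μ),K(μ)]`. -/
def ellipticWInv (μ y : ℝ) : ℝ := Function.invFunOn (ellipticW μ) (Icc (-1) 1) y

/-- The Jacobi elliptic function `sn(·,μ)`: on `[-K,K]` it is the inverse of `w`, it is symmetric
about `K`, and it is `4K`-periodic. The number `r` is the representative of `y` modulo `4K` in
`[-K,3K)`. -/
def jacobiSn (y μ : ℝ) : ℝ :=
  let K := ellipticK μ
  let r := 4 * K * Int.fract ((y + K) / (4 * K)) - K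
  if r ≤ K then ellipticWInv μ r else ellipticWInv μ (2 * K - r)

/-- The nome `exp(-π K(√(1-μ²)) / K(μ))` of the modulus `μ ∈ (0,1)`. -/
def nome (μ : ℝ) : ℝ := Real.exp (-(Real.pi * ellipticK (√(1 - μ ^ 2)) / ellipticK μ))

/-! ### The Gross-Pitaevskii eigenvalue problem -/

/-- `u` is a nonzero solution, twice continuously differentiable on `[0,1]`, of `u'' - u³ + η u = 0`
on `(0,1)` with `u(0) = u(1) = 0`. -/
structure IsEigenfunction (η : ℝ) (u : ℝ → ℝ) : Prop where
  contDiffOn : ContDiffOn ℝ 2 u (Icc 0 1)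
  ode : ∀ x ∈ Ioo (0 : ℝ) 1, deriv (deriv u) x - u x ^ 3 + η * u x = 0
  left : u 0 = 0
  right : u 1 = 0
  ne_zero : ∃ x ∈ Icc (0 : ℝ) 1, u x ≠ 0

/-- The eigenfunction `u_n(x,μ) = 2^{3/2} n μ K(μ) sn(2K(μ)nx, μ)`. -/
def eigenfunction (n : ℕ+) (μ x : ℝ) : ℝ :=
  (2 : ℝ) ^ (3 / 2 : ℝ) * n * μ * ellipticK μ * jacobiSn (2 * ellipticK μ * n * x) μ

/-- The eigenvalue `η_n = 4 n² (1+μ²) K(μ)²`. -/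
def eigenvalue (n : ℕ+) (μ : ℝ) : ℝ := 4 * (n : ℝ) ^ 2 * (1 + μ ^ 2) * ellipticK μ ^ 2

/-! ### The threshold -/

/-- `s_α(q) = ∑_{l ≥ 0} (2l+1)^α (1-q) q^l / (1-q^{2l+1})`. -/
def sFun (α q : ℝ) : ℝ :=
  ∑' l : ℕ, (2 * (l : ℝ) + 1) ^ α * ((1 - q) * q ^ l / (1 - q ^ (2 * l + 1)))

/-- The sequences in `(0,1)` whose supremum is less than `r`. -/
def admissibleNomes (r : ℝ) : Set (ℕ+ → ℝ) := {q | (∀ n, q n ∈ Ioo 0 1) ∧ ⨆ n, q n < r}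

end GrossPitaevskii

end

/-!
Write `q = exp(-2θ)`. Up to constant factors, the Jacobi sine of nome `q` is the series
`S(x) = ∑ sin((2i+1)x) / sinh((2i+1)θ)` over all odd integers `2i+1` (`jacobiSeries`). Hence `u_n` is
a multiple of `sin(nπx) + ∑_{l ≥ 1} τ_l sin((2l+1)nπx)` with `τ_l = (1-q)q^l / (1-q^{2l+1})`
(`harmonicRatio`). In the orthonormal basis `n^{-α} √2 sin(nπx)` of `H^α` the passage from the `n`-th
basis vector to `u_n` is, up to a nonzero scalar, the identity plus a sum over `l ≥ 1` of weighted
shifts of norm at most `(2l+1)^α τ_l(sup q_n)`. These bounds add up to `s_α(sup q_n) - 1 < 1`, so a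
Neumann series inverts the operator (`exists_harmonic_equiv`) and the images of an orthonormal basis
form an unconditional basis. Existence and uniqueness of the threshold follow from the continuity
and strict monotonicity of `s_α`, which equals `1` at `q = 0` and dominates `∑ q^l / (2l+1)`.

The Fourier series of the Jacobi sine is obtained without elliptic function theory. Let
`G(w) = ∑ e^{(2i+1)w} / sinh((2i+1)θ)` on the strip `|Re w| < θ`, so that `G(ix) = i S(x)`. The
identity `1/(sinh a sinh b) = (coth a + coth b)/sinh(a+b)` makes the convolution sums for the
coefficients of `G²` and `G³` telescope; the outcome is `G'' = 2G³ + κG`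
(`exists_oddSeries_ode`), and by integration
`G'² = (G² + M²)(G² + lam²)` with `M = S(π/2)` (`exists_jacobiSeries_factor`). A critical point of `S`
is a centre of symmetry by uniqueness for the differential equation; one inside `(-π/2, π/2)` would
give `S` a period smaller than `2π`, contradicting its nonzero first Fourier coefficient. So `S`
increases on this interval, and `S/M` is the inverse of `w_μ` up to scaling, with `μ = M/lam` and
`K(μ) = lam π/2` (`ellipticW_jacobiSeries`). On the real segment `G` increases to infinity as
`w → θ`, and the substitution `t = G/√(M²+G²)` yields `K(√(1-μ²)) = lam θ`
(`ellipticK_complementary`). Therefore `μ` has nome `exp(-2θ) = q`, and since the nome is strictly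
increasing in the modulus, every modulus of nome `q` arises in this way.
-/

noncomputable section

namespace GrossPitaevskii

open Filter Topology

/-! ### Convolutions of hyperbolic cosecants over the odd integers -/

/-- The coefficients `1 / sinh((2i+1)θ)` of the series for the Jacobi function of nome
`exp(-2θ)`, indexed by the odd integers `2i+1`. -/
def cschOdd (θ : ℝ) (i : ℤ) : ℝ := (Real.sinh ((2 * i + 1) * θ))⁻¹

/-- `coth((2i+1)θ)`. -/
def cothOdd (θ : ℝ) (i : ℤ) : ℝ := Real.cosh ((2 * i + 1) * θ) / Real.sinh ((2 * i + 1) * θ)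

theorem _root_.HasSum.of_eq {ι E : Type*} [AddCommMonoid E] [TopologicalSpace E] {f g : ι → E}
    {a b : E} (h : HasSum f a) (hf : ∀ i, g i = f i) (hab : b = a) : HasSum g b := by
  rw [hab, funext hf]
  exact h

theorem odd_cast_ne_zero (i : ℤ) : (2 * i + 1 : ℝ) ≠ 0 := by
  have : (2 * i + 1 : ℤ) ≠ 0 := by omega
  exact_mod_cast this

theorem one_le_abs_odd_cast (i : ℤ) : (1 : ℝ) ≤ |(2 * i + 1 : ℝ)| := by
  have : (1 : ℤ) ≤ |2 * i + 1| := Int.one_le_abs (by omega)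
  exact_mod_cast this

theorem sinh_odd_ne_zero {θ : ℝ} (hθ : 0 < θ) (i : ℤ) : Real.sinh ((2 * i + 1) * θ) ≠ 0 := by
  rw [Ne, Real.sinh_eq_zero]
  exact mul_ne_zero (odd_cast_ne_zero i) hθ.ne'

theorem summable_exp_neg_odd {δ : ℝ} (hδ : 0 < δ) :
    Summable fun i : ℤ => Real.exp (-(|(2 * i + 1 : ℝ)| * δ)) := by
  have h : Summable fun n : ℕ => Real.exp (-((n : ℝ) * δ)) := by
    have := Real.summable_exp_nat_mul_iff (a := -δ)
    simpa using this.2 (by linarith)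
  refine Summable.of_nat_of_neg ?_ ?_
  · refine Summable.of_nonneg_of_le (fun _ => (Real.exp_pos _).le) (fun n => ?_) h
    rw [Real.exp_le_exp]
    have : (n : ℝ) ≤ |2 * ((n : ℤ) : ℝ) + 1| := by
      push_cast
      rw [abs_of_nonneg (by positivity)]
      have : (0 : ℝ) ≤ n := by positivity
      linarith
    nlinarith
  · refine Summable.of_nonneg_of_le (fun _ => (Real.exp_pos _).le) (fun n => ?_)
      (h.mul_left (Real.exp δ))
    rw [← Real.exp_add, Real.exp_le_exp]
    have : (n : ℝ) - 1 ≤ |2 * ((-(n : ℤ) : ℤ) : ℝ) + 1| := by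
      push_cast
      have h0 : (0 : ℝ) ≤ n := by positivity
      have := neg_le_abs (2 * -(n : ℝ) + 1)
      linarith
    nlinarith

theorem abs_cschOdd_le {θ : ℝ} (hθ : 0 < θ) :
    ∃ C : ℝ, 0 < C ∧ ∀ i : ℤ, |cschOdd θ i| ≤ C * Real.exp (-(|(2 * i + 1 : ℝ)| * θ)) := by
  have h1 : 0 < 1 - Real.exp (-(2 * θ)) := by
    rw [sub_pos, Real.exp_lt_one_iff]; linarith
  refine ⟨2 / (1 - Real.exp (-(2 * θ))), by positivity, fun i => ?_⟩
  have hx : θ ≤ |(2 * i + 1 : ℝ)| * θ := by nlinarith [one_le_abs_odd_cast i]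
  rw [cschOdd, abs_inv, Real.abs_sinh, abs_mul, abs_of_pos hθ]
  set x := |(2 * i + 1 : ℝ)| * θ
  have h2 : Real.exp x * (1 - Real.exp (-(2 * θ))) / 2 ≤ Real.sinh x := by
    rw [Real.sinh_eq]
    have : Real.exp (-x) ≤ Real.exp x * Real.exp (-(2 * θ)) := by
      rw [← Real.exp_add, Real.exp_le_exp]; linarith
    linarith
  calc (Real.sinh x)⁻¹ ≤ (Real.exp x * (1 - Real.exp (-(2 * θ))) / 2)⁻¹ :=
        inv_anti₀ (by positivity) h2
    _ = _ := by rw [Real.exp_neg x]; field_simp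

theorem summable_abs_cschOdd {θ : ℝ} (hθ : 0 < θ) : Summable fun i : ℤ => |cschOdd θ i| := by
  obtain ⟨C, -, h⟩ := abs_cschOdd_le hθ
  exact Summable.of_nonneg_of_le (fun _ => abs_nonneg _) h ((summable_exp_neg_odd hθ).mul_left C)

theorem cschOdd_neg (θ : ℝ) (i : ℤ) : cschOdd θ (-1 - i) = -cschOdd θ i := by
  rw [cschOdd, cschOdd, ← inv_neg, ← Real.sinh_neg]
  congr 2; push_cast; ring

theorem cothOdd_neg (θ : ℝ) (i : ℤ) : cothOdd θ (-1 - i) = -cothOdd θ i := by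
  have : ((2 * ((-1 - i : ℤ) : ℝ) + 1) * θ) = -((2 * i + 1) * θ) := by push_cast; ring
  rw [cothOdd, cothOdd, this, Real.sinh_neg, Real.cosh_neg, div_neg]

theorem cschOdd_mul_cschOdd {θ : ℝ} (hθ : 0 < θ) (i n : ℤ) :
    Real.sinh (2 * (n + 1) * θ) * (cschOdd θ i * cschOdd θ (n - i)) =
      cothOdd θ i - cothOdd θ (i - (n + 1)) := by
  have h1 := sinh_odd_ne_zero hθ i
  have h2 := sinh_odd_ne_zero hθ (n - i)
  have h3 : cothOdd θ (i - (n + 1)) = -cothOdd θ (n - i) := by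
    rw [← cothOdd_neg]; congr 1; ring
  rw [h3, cschOdd, cschOdd, cothOdd, cothOdd]
  have h4 : (2 * ((n : ℝ) + 1) * θ) = (2 * i + 1) * θ + (2 * ((n - i : ℤ) : ℝ) + 1) * θ := by
    push_cast; ring
  rw [h4, Real.sinh_add]
  generalize (2 * (i : ℝ) + 1) * θ = x at *
  generalize (2 * ((n - i : ℤ) : ℝ) + 1) * θ = y at *
  field_simp
  ring

theorem hasSum_cothOdd_sub_one {θ : ℝ} (hθ : 0 < θ) :
    HasSum (fun i : ℤ => cothOdd θ i - cothOdd θ (i - 1)) 2 := by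
  -- `coth` differs from the sign function by a summable error, and that error telescopes away
  obtain ⟨sg, hp, hn⟩ : ∃ sg : ℤ → ℝ, (∀ i, 0 ≤ i → sg i = 1) ∧ ∀ i, i < 0 → sg i = -1 :=
    ⟨fun i => if 0 ≤ i then 1 else -1, fun i hi => if_pos hi, fun i hi => if_neg (by omega)⟩
  have hes : Summable fun i => cothOdd θ i - sg i := by
    refine Summable.of_norm_bounded (summable_abs_cschOdd hθ) fun i => ?_
    have h2 : cothOdd θ i - sg i = cschOdd θ i * (Real.cosh ((2 * i + 1) * θ) -
        sg i * Real.sinh ((2 * i + 1) * θ)) := by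
      rw [cothOdd, cschOdd, mul_sub, mul_left_comm, inv_mul_cancel₀ (sinh_odd_ne_zero hθ i),
        div_eq_inv_mul, mul_one]
    rw [h2, norm_mul, Real.norm_eq_abs, Real.norm_eq_abs]
    refine mul_le_of_le_one_right (abs_nonneg _) ?_
    rcases le_or_gt 0 i with h | h
    · rw [hp i h, one_mul, Real.cosh_sub_sinh, abs_of_pos (Real.exp_pos _), Real.exp_le_one_iff]
      have : (0 : ℝ) ≤ i := by exact_mod_cast h
      have : 0 ≤ (2 * i + 1) * θ := by positivity
      linarith
    · rw [hn i h, neg_one_mul, sub_neg_eq_add, Real.cosh_add_sinh, abs_of_pos (Real.exp_pos _),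
        Real.exp_le_one_iff]
      have : (i : ℝ) ≤ -1 := by exact_mod_cast (by omega : i ≤ -1)
      nlinarith
  have h2 := hes.hasSum.sub ((Equiv.subRight (1 : ℤ)).hasSum_iff.2 hes.hasSum)
  have h3 : HasSum (fun i : ℤ => sg i - sg (i - 1)) (sg 0 - sg (0 - 1)) := by
    refine hasSum_single 0 fun i hi => ?_
    rcases lt_or_gt_of_ne hi with h | h
    · rw [hn _ h, hn _ (by omega), sub_self]
    · rw [hp _ h.le, hp _ (by omega), sub_self]
  refine (h2.add h3).of_eq (fun i => ?_) ?_
  · simp only [Function.comp, Equiv.subRight_apply]; ring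
  · rw [hp 0 le_rfl, hn _ (by norm_num)]; ring

theorem hasSum_cothOdd_sub {θ : ℝ} (hθ : 0 < θ) (m : ℤ) :
    HasSum (fun i : ℤ => cothOdd θ i - cothOdd θ (i - m)) (2 * m) := by
  have h1 : ∀ m : ℤ, HasSum (fun i : ℤ => cothOdd θ (i - m) - cothOdd θ (i - (m + 1))) 2 := by
    intro m
    refine ((Equiv.subRight m).hasSum_iff.2 (hasSum_cothOdd_sub_one hθ)).of_eq (fun i => ?_) rfl
    simp only [Function.comp, Equiv.subRight_apply]
    rw [show i - (m + 1) = i - m - 1 by ring]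
  induction m with
  | zero => simp
  | succ k ih =>
    refine (ih.add (h1 k)).of_eq (fun i => ?_) ?_
    · ring
    · push_cast; ring
  | pred k ih =>
    refine (ih.sub (h1 (-k - 1))).of_eq (fun i => ?_) ?_
    · rw [show -(k : ℤ) - 1 + 1 = -k by ring]; ring
    · push_cast; ring

/-- The convolution square of `1 / sinh` over the odd integers. -/
theorem tsum_cschOdd_mul {θ : ℝ} (hθ : 0 < θ) {n : ℤ} (hn : n ≠ -1) :
    ∑' i : ℤ, cschOdd θ i * cschOdd θ (n - i) = 2 * (n + 1) / Real.sinh (2 * (n + 1) * θ) := by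
  have h0 : Real.sinh (2 * (n + 1) * θ) ≠ 0 := by
    rw [Ne, Real.sinh_eq_zero]
    have : (n + 1 : ℝ) ≠ 0 := by exact_mod_cast (by omega : n + 1 ≠ 0)
    simp [this, hθ.ne']
  rw [eq_div_iff h0, mul_comm, ← tsum_mul_left]
  simp only [cschOdd_mul_cschOdd hθ]
  have := (hasSum_cothOdd_sub hθ (n + 1)).tsum_eq
  push_cast at this
  exact this

theorem summable_mul_cschOdd_mul {θ : ℝ} (hθ : 0 < θ) (n : ℤ) :
    Summable fun m : ℤ => 2 * m / Real.sinh (2 * m * θ) * cschOdd θ (n - m) := by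
  have h1 : Summable fun m : ℤ => θ⁻¹ * |cschOdd θ (n - m)| :=
    ((Equiv.subLeft n).summable_iff.2 (summable_abs_cschOdd hθ)).mul_left θ⁻¹
  refine Summable.of_norm_bounded h1 fun m => ?_
  rw [norm_mul]
  refine mul_le_mul_of_nonneg_right ?_ (norm_nonneg _)
  rw [Real.norm_eq_abs, abs_div, Real.abs_sinh]
  rcases eq_or_ne m 0 with rfl | hm
  · simp [hθ.le]
  have : (0 : ℝ) < |2 * m * θ| := by
    have : (m : ℝ) ≠ 0 := by exact_mod_cast hm
    positivity
  rw [div_le_iff₀ (Real.sinh_pos_iff.2 this)]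
  have h2 := Real.self_le_sinh_iff.2 this.le
  rw [abs_mul _ θ, abs_of_pos hθ] at *
  rw [inv_mul_eq_div, le_div_iff₀ hθ]
  exact h2

theorem even_mul_cschOdd {θ : ℝ} (hθ : 0 < θ) (m n : ℤ) :
    Real.sinh ((2 * n + 1) * θ) * (2 * m / Real.sinh (2 * m * θ) * cschOdd θ (n - m)) =
      2 * m * (Real.cosh (2 * m * θ) / Real.sinh (2 * m * θ) + cothOdd θ (n - m)) := by
  rcases eq_or_ne m 0 with rfl | hm
  · simp
  have h1 : Real.sinh (2 * m * θ) ≠ 0 := by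
    rw [Ne, Real.sinh_eq_zero]
    have : (m : ℝ) ≠ 0 := by exact_mod_cast hm
    simp [this, hθ.ne']
  have h2 := sinh_odd_ne_zero hθ (n - m)
  have h4 : (2 * (n : ℝ) + 1) * θ = 2 * m * θ + (2 * ((n - m : ℤ) : ℝ) + 1) * θ := by
    push_cast; ring
  rw [cschOdd, cothOdd, h4, Real.sinh_add]
  generalize 2 * (m : ℝ) * θ = x at *
  generalize (2 * ((n - m : ℤ) : ℝ) + 1) * θ = y at *
  field_simp
  ring

theorem hasSum_mul_cothOdd_sub_one {θ : ℝ} (hθ : 0 < θ) :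
    HasSum (fun k : ℤ => (k : ℝ) * (cothOdd θ k - cothOdd θ (k - 1))) 0 := by
  have hs : Summable fun k : ℤ => (k : ℝ) * (cothOdd θ k - cothOdd θ (k - 1)) := by
    obtain ⟨C, hC, h⟩ := abs_cschOdd_le hθ
    have h1 := (summable_abs_cschOdd hθ).mul_left (|Real.sinh (2 * θ)| * C * θ⁻¹)
    refine Summable.of_norm_bounded h1 fun k => ?_
    have h2 := cschOdd_mul_cschOdd hθ k 0
    simp only [Int.cast_zero, zero_add, mul_one, zero_sub] at h2
    rw [← h2, show (-k : ℤ) = -1 - (k - 1) by ring, cschOdd_neg]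
    have h3 : |(k : ℝ)| * |cschOdd θ (k - 1)| ≤ C * θ⁻¹ := by
      refine (mul_le_mul_of_nonneg_left (h (k - 1)) (abs_nonneg _)).trans ?_
      rw [mul_left_comm]
      refine mul_le_mul_of_nonneg_left ?_ hC.le
      set x := |(2 * ((k - 1 : ℤ) : ℝ) + 1 : ℝ)| with hx
      have h5 : |(k : ℝ)| ≤ x := by
        have : |k| ≤ |2 * (k - 1) + 1| := by
          rcases abs_cases k with h | h <;> rcases abs_cases (2 * (k - 1) + 1) with h' | h' <;>
            omega
        rw [hx]; exact_mod_cast this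
      have h6 : x * θ ≤ Real.exp (x * θ) := by linarith [Real.add_one_le_exp (x * θ)]
      rw [Real.exp_neg, ← div_eq_mul_inv, div_le_iff₀ (Real.exp_pos _), inv_mul_eq_div,
        le_div_iff₀ hθ]
      nlinarith
    simp only [norm_mul, Real.norm_eq_abs, abs_neg]
    have h7 := mul_le_mul_of_nonneg_left h3
      (mul_nonneg (abs_nonneg (Real.sinh (2 * θ))) (abs_nonneg (cschOdd θ k)))
    nlinarith
  have h1 := hs.hasSum
  -- the summand is odd
  have h2 := (Equiv.neg ℤ).hasSum_iff.2 h1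
  have h3 : (fun k : ℤ => (k : ℝ) * (cothOdd θ k - cothOdd θ (k - 1))) ∘ (Equiv.neg ℤ) =
      fun k : ℤ => -((k : ℝ) * (cothOdd θ k - cothOdd θ (k - 1))) := by
    funext k
    simp only [Function.comp, Equiv.neg_apply]
    rw [show -k = -1 - (k - 1) by ring, show -1 - (k - 1) - 1 = -1 - k by ring, cothOdd_neg,
      cothOdd_neg]
    push_cast; ring
  rw [h3] at h2
  have h4 := h2.unique h1.neg
  rwa [show ∑' k : ℤ, (k : ℝ) * (cothOdd θ k - cothOdd θ (k - 1)) = 0 by linarith] at h1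

/-- The convolution of `2m / sinh(2mθ)` over the even integers with `1 / sinh` over the odd ones:
up to the factor `1 / sinh((2n+1)θ)` it is a quadratic polynomial in `n`. -/
theorem exists_tsum_mul_cschOdd {θ : ℝ} (hθ : 0 < θ) : ∃ D : ℝ, ∀ n : ℤ,
    ∑' m : ℤ, 2 * m / Real.sinh (2 * m * θ) * cschOdd θ (n - m) =
      (2 * n ^ 2 + 2 * n + D) * cschOdd θ n := by
  set T : ℤ → ℝ := fun n => ∑' m : ℤ, 2 * m *
    (Real.cosh (2 * m * θ) / Real.sinh (2 * m * θ) + cothOdd θ (n - m)) with hT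
  have hs : ∀ n, HasSum (fun m : ℤ => 2 * m *
      (Real.cosh (2 * m * θ) / Real.sinh (2 * m * θ) + cothOdd θ (n - m))) (T n) := by
    intro n
    have := (summable_mul_cschOdd_mul hθ n).mul_left (Real.sinh ((2 * n + 1) * θ))
    simp only [even_mul_cschOdd hθ] at this
    exact this.hasSum
  have hstep : ∀ n, T (n + 1) = T n + 4 * (n + 1) := by
    intro n
    have h1 := (hs (n + 1)).sub (hs n)
    have h2 := ((hasSum_cothOdd_sub_one hθ).mul_left (2 * (n + 1 : ℝ))).sub
      ((hasSum_mul_cothOdd_sub_one hθ).mul_left 2)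
    have h3 := (Equiv.subLeft (n + 1)).hasSum_iff.2 h2
    have h4 := h1.unique (h3.of_eq (fun m => by
      simp only [Function.comp, Equiv.subLeft_apply]
      rw [show n + 1 - m - 1 = n - m by ring]
      push_cast; ring) rfl)
    linarith
  have hT : ∀ n, T n = 2 * n ^ 2 + 2 * n + T 0 := by
    intro n
    induction n with
    | zero => simp
    | succ k ih => rw [hstep, ih]; push_cast; ring
    | pred k ih =>
      have := hstep (-k - 1)
      rw [show -(k : ℤ) - 1 + 1 = -k by ring, ih] at this
      push_cast at this ⊢
      linarith
  refine ⟨T 0, fun n => ?_⟩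
  rw [← hT n, cschOdd, ← div_eq_mul_inv, eq_div_iff (sinh_odd_ne_zero hθ n), mul_comm,
    ← tsum_mul_left]
  simp only [even_mul_cschOdd hθ]
  rfl

/-! ### The exponential series on a strip -/

/-- The exponential series `∑ cᵢ e^{(2i+1)w}` over the odd integers. -/
def oddSeries (c : ℤ → ℝ) (w : ℂ) : ℂ := ∑' i : ℤ, (c i : ℂ) * Complex.exp ((2 * i + 1) * w)

/-- Coefficients for which `oddSeries` converges absolutely on the strip `|Re w| < θ`. -/
def StripSummable (θ : ℝ) (c : ℤ → ℝ) : Prop :=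
  ∀ ρ < θ, Summable fun i : ℤ => |c i| * Real.exp (|(2 * i + 1 : ℝ)| * ρ)

/-- The strip `|Re w| < θ`. -/
def strip (θ : ℝ) : Set ℂ := {w | |w.re| < θ}

theorem isOpen_strip (θ : ℝ) : IsOpen (strip θ) :=
  isOpen_lt (by fun_prop) continuous_const

theorem isPreconnected_strip (θ : ℝ) : IsPreconnected (strip θ) := by
  have : strip θ = Complex.reLm ⁻¹' (Ioo (-θ) θ) := by
    ext w; simp [strip, abs_lt]
  rw [this]
  exact ((convex_Ioo (-θ) θ).linear_preimage _).isPreconnected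

theorem norm_oddSeries_term_le (c : ℤ → ℝ) (i : ℤ) {w : ℂ} {ρ : ℝ} (hw : |w.re| ≤ ρ) :
    ‖(c i : ℂ) * Complex.exp ((2 * i + 1) * w)‖ ≤ |c i| * Real.exp (|(2 * i + 1 : ℝ)| * ρ) := by
  rw [norm_mul, Complex.norm_real, Real.norm_eq_abs, Complex.norm_exp]
  refine mul_le_mul_of_nonneg_left (Real.exp_le_exp.2 ?_) (abs_nonneg _)
  have : ((2 * i + 1) * w).re = (2 * i + 1 : ℝ) * w.re := by
    have : ((2 * i + 1 : ℂ)) = ((2 * i + 1 : ℝ) : ℂ) := by push_cast; rfl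
    rw [this, Complex.re_ofReal_mul]
  rw [this]
  refine (le_abs_self _).trans ?_
  rw [abs_mul]
  exact mul_le_mul_of_nonneg_left hw (abs_nonneg _)

theorem StripSummable.summable_norm {θ : ℝ} {c : ℤ → ℝ} (hc : StripSummable θ c) {w : ℂ}
    (hw : w ∈ strip θ) : Summable fun i : ℤ => ‖(c i : ℂ) * Complex.exp ((2 * i + 1) * w)‖ :=
  Summable.of_nonneg_of_le (fun _ => norm_nonneg _) (fun i => norm_oddSeries_term_le c i le_rfl)
    (hc _ hw)

theorem StripSummable.hasSum {θ : ℝ} {c : ℤ → ℝ} (hc : StripSummable θ c) {w : ℂ}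
    (hw : w ∈ strip θ) :
    HasSum (fun i : ℤ => (c i : ℂ) * Complex.exp ((2 * i + 1) * w)) (oddSeries c w) :=
  (hc.summable_norm hw).of_norm.hasSum

theorem StripSummable.odd_mul {θ : ℝ} {c : ℤ → ℝ} (hc : StripSummable θ c) :
    StripSummable θ fun i => (2 * i + 1) * c i := by
  intro ρ hρ
  obtain ⟨ρ', h1, h2⟩ := exists_between hρ
  have hε : 0 < ρ' - ρ := by linarith
  refine Summable.of_nonneg_of_le (fun _ => by positivity) (fun i => ?_)
    ((hc ρ' h2).mul_left (ρ' - ρ)⁻¹)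
  rw [abs_mul]
  set x := |(2 * i + 1 : ℝ)|
  have h3 : x * (ρ' - ρ) ≤ Real.exp (x * (ρ' - ρ)) := by
    linarith [Real.add_one_le_exp (x * (ρ' - ρ))]
  have h4 : Real.exp (x * ρ') = Real.exp (x * (ρ' - ρ)) * Real.exp (x * ρ) := by
    rw [← Real.exp_add]; ring_nf
  rw [h4, inv_mul_eq_div, le_div_iff₀ hε]
  calc x * |c i| * Real.exp (x * ρ) * (ρ' - ρ)
      = (x * (ρ' - ρ)) * (|c i| * Real.exp (x * ρ)) := by ring
    _ ≤ Real.exp (x * (ρ' - ρ)) * (|c i| * Real.exp (x * ρ)) :=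
        mul_le_mul_of_nonneg_right h3 (by positivity)
    _ = _ := by ring

theorem StripSummable.hasDerivAt {θ : ℝ} {c : ℤ → ℝ} (hc : StripSummable θ c) {w : ℂ}
    (hw : w ∈ strip θ) :
    HasDerivAt (oddSeries c) (oddSeries (fun i => (2 * i + 1) * c i) w) w := by
  obtain ⟨ρ, h1, h2⟩ := exists_between (show |w.re| < θ from hw)
  refine hasDerivAt_tsum_of_isPreconnected
    (g := fun (i : ℤ) (w : ℂ) => (c i : ℂ) * Complex.exp ((2 * i + 1) * w))
    (g' := fun (i : ℤ) (w : ℂ) => (((2 * i + 1) * c i : ℝ) : ℂ) * Complex.exp ((2 * i + 1) * w))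
    (hc.odd_mul ρ h2) (isOpen_strip ρ) (isPreconnected_strip ρ) (fun i y _ => ?_)
    (fun i y hy => norm_oddSeries_term_le (fun i : ℤ => (2 * i + 1) * c i) i (le_of_lt hy))
    h1 (hc.summable_norm hw).of_norm h1
  have h3 : HasDerivAt (fun w : ℂ => (2 * i + 1 : ℂ) * w) (2 * i + 1) y := by
    simpa using (hasDerivAt_id y).const_mul (2 * i + 1 : ℂ)
  refine (h3.cexp.const_mul (c i : ℂ)).congr_deriv ?_
  push_cast; ring

/-- Cauchy products over `ℤ`. -/
theorem tsum_int_mul_tsum_int {f g : ℤ → ℂ} (hf : Summable fun i => ‖f i‖)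
    (hg : Summable fun i => ‖g i‖) :
    Summable (fun n : ℤ => ‖∑' i : ℤ, f i * g (n - i)‖) ∧
      HasSum (fun n : ℤ => ∑' i : ℤ, f i * g (n - i)) ((∑' i, f i) * ∑' i, g i) := by
  let e : ℤ × ℤ ≃ ℤ × ℤ :=
    { toFun := fun p => (p.2, p.1 - p.2)
      invFun := fun p => (p.1 + p.2, p.1)
      left_inv := fun p => by ext <;> simp
      right_inv := fun p => by ext <;> simp }
  have h1 : Summable fun p : ℤ × ℤ => ‖f p.1 * g p.2‖ := hf.mul_norm hg
  have h2 : Summable fun p : ℤ × ℤ => ‖f p.2 * g (p.1 - p.2)‖ := e.summable_iff.2 h1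
  have h3 : HasSum (fun p : ℤ × ℤ => f p.2 * g (p.1 - p.2)) ((∑' i, f i) * ∑' i, g i) := by
    rw [tsum_mul_tsum_of_summable_norm hf hg]
    exact e.hasSum_iff.2 h1.of_norm.hasSum
  refine ⟨?_, h3.prod_fiberwise fun n => (h2.prod_factor n).of_norm.hasSum⟩
  exact Summable.of_nonneg_of_le (fun _ => norm_nonneg _)
    (fun n => norm_tsum_le_tsum_norm (h2.prod_factor n)) h2.prod

theorem stripSummable_cschOdd {θ : ℝ} (hθ : 0 < θ) : StripSummable θ (cschOdd θ) := by
  intro ρ hρ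
  obtain ⟨C, hC, h⟩ := abs_cschOdd_le hθ
  refine Summable.of_nonneg_of_le (fun _ => by positivity) (fun i => ?_)
    ((summable_exp_neg_odd (sub_pos.2 hρ)).mul_left C)
  refine (mul_le_mul_of_nonneg_right (h i) (Real.exp_pos _).le).trans_eq ?_
  rw [mul_assoc, ← Real.exp_add]
  ring_nf

/-- The coefficients of the square of the series with coefficients `cschOdd θ`; the exponent
belonging to `n` is `2n+2`. -/
def cschSq (θ : ℝ) (n : ℤ) : ℝ := ∑' i : ℤ, cschOdd θ i * cschOdd θ (n - i)

/-- The coefficients of the cube of the series are, up to terms with a factor `κ`, those of its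
second derivative; the index `n` belongs to the exponent `2n+3`. -/
theorem exists_tsum_cschSq_mul {θ : ℝ} (hθ : 0 < θ) : ∃ κ : ℝ, ∀ n : ℤ,
    2 * ∑' i : ℤ, cschSq θ i * cschOdd θ (n - i) =
      ((2 * (n + 1) + 1) ^ 2 - κ) * cschOdd θ (n + 1) := by
  obtain ⟨D, hD⟩ := exists_tsum_mul_cschOdd hθ
  refine ⟨1 - 2 * D - 2 * cschSq θ (-1), fun n => ?_⟩
  have h1 := (summable_mul_cschOdd_mul hθ (n + 1)).hasSum
  rw [hD] at h1
  have h2 := (Equiv.addRight (1 : ℤ)).hasSum_iff.2 h1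
  have h3 : HasSum (fun i : ℤ => (Pi.single (-1) (cschSq θ (-1) * cschOdd θ (n + 1)) : ℤ → ℝ) i)
      (cschSq θ (-1) * cschOdd θ (n + 1)) := hasSum_pi_single _ _
  have h4 := (h2.add h3).of_eq (g := fun i : ℤ => cschSq θ i * cschOdd θ (n - i)) (fun i => ?_) rfl
  · rw [h4.tsum_eq]; push_cast; ring
  · simp only [Function.comp, Equiv.coe_addRight]
    rcases eq_or_ne i (-1) with rfl | hi
    · simp
    · rw [Pi.single_eq_of_ne hi, add_zero, cschSq, tsum_cschOdd_mul hθ hi]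
      push_cast
      rw [show n + 1 - (i + 1) = n - i by ring]

/-- The second-order differential equation of the Jacobi function, for the series of its
Fourier coefficients. -/
theorem exists_oddSeries_ode {θ : ℝ} (hθ : 0 < θ) : ∃ κ : ℝ, ∀ w ∈ strip θ,
    oddSeries (fun i => (2 * i + 1) * ((2 * i + 1) * cschOdd θ i)) w =
      2 * oddSeries (cschOdd θ) w ^ 3 + κ * oddSeries (cschOdd θ) w := by
  obtain ⟨κ, hκ⟩ := exists_tsum_cschSq_mul hθ
  refine ⟨κ, fun w hw => ?_⟩
  set f : ℤ → ℂ := fun i => (cschOdd θ i : ℂ) * Complex.exp ((2 * i + 1) * w) with hf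
  have hfs : Summable fun i => ‖f i‖ := (stripSummable_cschOdd hθ).summable_norm hw
  have h1 := tsum_int_mul_tsum_int hfs hfs
  have h2 : ∀ n : ℤ, ∑' i : ℤ, f i * f (n - i) =
      (cschSq θ n : ℂ) * Complex.exp ((2 * n + 2) * w) := by
    intro n
    rw [cschSq, Complex.ofReal_tsum, ← tsum_mul_right]
    refine tsum_congr fun i => ?_
    simp only [hf]
    rw [mul_mul_mul_comm, ← Complex.exp_add]
    push_cast
    ring_nf
  simp only [h2] at h1
  have h3 := (tsum_int_mul_tsum_int h1.1 hfs).2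
  rw [h1.2.tsum_eq] at h3
  have h4 : ∀ n : ℤ, ∑' i : ℤ, (cschSq θ i : ℂ) * Complex.exp ((2 * i + 2) * w) * f (n - i) =
      ((∑' i : ℤ, cschSq θ i * cschOdd θ (n - i) : ℝ) : ℂ) *
        Complex.exp ((2 * (n + 1) + 1) * w) := by
    intro n
    rw [Complex.ofReal_tsum, ← tsum_mul_right]
    refine tsum_congr fun i => ?_
    simp only [hf]
    rw [mul_mul_mul_comm, ← Complex.exp_add]
    push_cast
    ring_nf
  simp only [h4] at h3
  have h5 : HasSum f (∑' i, f i) := hfs.of_norm.hasSum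
  have h6 := (Equiv.addRight (1 : ℤ)).hasSum_iff.2 h5
  have h7 := (Equiv.addRight (1 : ℤ)).hasSum_iff.2
    ((stripSummable_cschOdd hθ).odd_mul.odd_mul.hasSum hw)
  refine h7.unique (((h3.mul_left 2).add (h6.mul_left (κ : ℂ))).of_eq (fun n => ?_) ?_)
  · have := congrArg (fun x : ℝ => (x : ℂ)) (hκ n)
    simp only [Function.comp, Equiv.coe_addRight, hf]
    push_cast at this ⊢
    rw [← mul_assoc 2, this]
    ring
  · rw [show oddSeries (cschOdd θ) w = ∑' i, f i from rfl]; ring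

/-- The first integral of the differential equation. -/
theorem exists_oddSeries_energy {θ : ℝ} (hθ : 0 < θ) : ∃ κ : ℝ, (∀ w ∈ strip θ,
    oddSeries (fun i => (2 * i + 1) * ((2 * i + 1) * cschOdd θ i)) w =
      2 * oddSeries (cschOdd θ) w ^ 3 + κ * oddSeries (cschOdd θ) w) ∧
    ∀ w ∈ strip θ, oddSeries (fun i => (2 * i + 1) * cschOdd θ i) w ^ 2 =
      oddSeries (cschOdd θ) w ^ 4 + κ * oddSeries (cschOdd θ) w ^ 2 +
        oddSeries (fun i => (2 * i + 1) * cschOdd θ i) 0 ^ 2 := by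
  obtain ⟨κ, hκ⟩ := exists_oddSeries_ode hθ
  refine ⟨κ, hκ, fun w hw => ?_⟩
  have hc := stripSummable_cschOdd hθ
  have hd : ∀ w ∈ strip θ, HasDerivAt (fun w => oddSeries (fun i => (2 * i + 1) * cschOdd θ i) w ^ 2
      - oddSeries (cschOdd θ) w ^ 4 - κ * oddSeries (cschOdd θ) w ^ 2) 0 w := by
    intro w hw
    have h1 := hc.hasDerivAt hw
    have h2 := hc.odd_mul.hasDerivAt hw
    rw [hκ w hw] at h2
    refine (((h2.fun_pow 2).fun_sub (h1.fun_pow 4)).fun_sub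
      ((h1.fun_pow 2).const_mul (κ : ℂ))).congr_deriv ?_
    norm_num
    ring
  have h0 : (0 : ℂ) ∈ strip θ := by simpa [strip] using hθ
  have h := (isOpen_strip θ).is_const_of_deriv_eq_zero (isPreconnected_strip θ)
    (fun w hw => (hd w hw).differentiableAt.differentiableWithinAt) (fun w hw => (hd w hw).deriv)
    hw h0
  have h00 : oddSeries (cschOdd θ) 0 = 0 := by
    have h1 := hc.hasSum h0
    have h2 := (Equiv.subLeft (-1 : ℤ)).hasSum_iff.2 h1
    have h3 := h2.unique (h1.neg.of_eq (fun i => by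
      simp only [Function.comp, Equiv.subLeft_apply, cschOdd_neg, mul_zero, Complex.exp_zero]
      push_cast; ring) rfl)
    linear_combination h3 / 2
  rw [h00] at h
  linear_combination h

/-! ### The series on the imaginary axis -/

theorem oddSeries_neg_of_odd {c : ℤ → ℝ} (hc : ∀ i, c (-1 - i) = -c i) (w : ℂ) :
    oddSeries c (-w) = -oddSeries c w := by
  rw [oddSeries, oddSeries, ← (Equiv.subLeft (-1 : ℤ)).tsum_eq, ← tsum_neg]
  refine tsum_congr fun i => ?_
  rw [Equiv.subLeft_apply, hc]
  push_cast; ring_nf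

theorem oddSeries_neg_of_even {c : ℤ → ℝ} (hc : ∀ i, c (-1 - i) = c i) (w : ℂ) :
    oddSeries c (-w) = oddSeries c w := by
  rw [oddSeries, oddSeries, ← (Equiv.subLeft (-1 : ℤ)).tsum_eq]
  refine tsum_congr fun i => ?_
  rw [Equiv.subLeft_apply, hc]
  push_cast; ring_nf

theorem oddSeries_conj (c : ℤ → ℝ) (w : ℂ) :
    oddSeries c (starRingEnd ℂ w) = starRingEnd ℂ (oddSeries c w) := by
  rw [oddSeries, oddSeries, Complex.conj_tsum]
  refine tsum_congr fun i => ?_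
  rw [map_mul, Complex.conj_ofReal, ← Complex.exp_conj, map_mul, map_add, map_mul, map_ofNat,
    map_one, map_intCast]

theorem odd_mul_cschOdd_neg (θ : ℝ) (i : ℤ) :
    (2 * ((-1 - i : ℤ) : ℝ) + 1) * cschOdd θ (-1 - i) = (2 * i + 1) * cschOdd θ i := by
  rw [cschOdd_neg]; push_cast; ring

/-- The real function `∑ sin((2i+1)x) / sinh((2i+1)θ)`, summed over all odd integers `2i+1`; up to
scaling it is the Jacobi function of nome `exp(-2θ)`. -/
def jacobiSeries (θ x : ℝ) : ℝ := (oddSeries (cschOdd θ) (x * Complex.I)).im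

/-- The derivative of `jacobiSeries`. -/
def jacobiSeriesDeriv (θ x : ℝ) : ℝ :=
  (oddSeries (fun i => (2 * i + 1) * cschOdd θ i) (x * Complex.I)).re

theorem mul_I_mem_strip {θ : ℝ} (hθ : 0 < θ) (x : ℝ) : (x * Complex.I : ℂ) ∈ strip θ := by
  simpa [strip] using hθ

theorem conj_mul_I (x : ℝ) : starRingEnd ℂ (x * Complex.I) = -(x * Complex.I) := by simp

theorem oddSeries_cschOdd_mul_I (θ x : ℝ) :
    oddSeries (cschOdd θ) (x * Complex.I) = jacobiSeries θ x * Complex.I := by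
  have h := oddSeries_conj (cschOdd θ) (x * Complex.I)
  rw [conj_mul_I, oddSeries_neg_of_odd (cschOdd_neg θ)] at h
  have h1 := congrArg Complex.re h
  rw [Complex.neg_re, Complex.conj_re] at h1
  apply Complex.ext
  · simp; linarith
  · simp [jacobiSeries]

theorem oddSeries_odd_mul_cschOdd_mul_I (θ x : ℝ) :
    oddSeries (fun i => (2 * i + 1) * cschOdd θ i) (x * Complex.I) = jacobiSeriesDeriv θ x := by
  have h := oddSeries_conj (fun i => (2 * i + 1) * cschOdd θ i) (x * Complex.I)
  rw [conj_mul_I, oddSeries_neg_of_even (odd_mul_cschOdd_neg θ)] at h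
  have h1 := congrArg Complex.im h
  rw [Complex.conj_im] at h1
  apply Complex.ext
  · simp [jacobiSeriesDeriv]
  · simp; linarith

theorem hasDerivAt_mul_I {f : ℂ → ℂ} {f' : ℂ} {x : ℝ} (h : HasDerivAt f f' (x * Complex.I)) :
    HasDerivAt (fun y : ℝ => f (y * Complex.I)) (f' * Complex.I) x := by
  have h1 : HasDerivAt (fun y : ℂ => y * Complex.I) Complex.I (x : ℂ) := by
    simpa using (hasDerivAt_id (x : ℂ)).mul_const Complex.I
  exact (h.comp (x : ℂ) h1).comp_ofReal

theorem hasDerivAt_jacobiSeries {θ : ℝ} (hθ : 0 < θ) (x : ℝ) :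
    HasDerivAt (jacobiSeries θ) (jacobiSeriesDeriv θ x) x := by
  have h := hasDerivAt_mul_I ((stripSummable_cschOdd hθ).hasDerivAt (mul_I_mem_strip hθ x))
  refine (Complex.imCLM.hasFDerivAt.comp_hasDerivAt x h).congr_deriv ?_
  simp [jacobiSeriesDeriv]

/-- The differential equation and its first integral on the imaginary axis and on the real
segment of the strip. -/
theorem exists_jacobiSeries_ode {θ : ℝ} (hθ : 0 < θ) : ∃ κ : ℝ,
    (∀ x, HasDerivAt (jacobiSeriesDeriv θ)
      (2 * jacobiSeries θ x ^ 3 - κ * jacobiSeries θ x) x) ∧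
    (∀ x, jacobiSeriesDeriv θ x ^ 2 =
      jacobiSeries θ x ^ 4 - κ * jacobiSeries θ x ^ 2 + jacobiSeriesDeriv θ 0 ^ 2) ∧
    ∀ w ∈ strip θ, oddSeries (fun i => (2 * i + 1) * cschOdd θ i) w ^ 2 =
      oddSeries (cschOdd θ) w ^ 4 + κ * oddSeries (cschOdd θ) w ^ 2 +
        (jacobiSeriesDeriv θ 0 : ℂ) ^ 2 := by
  obtain ⟨κ, h1, h2⟩ := exists_oddSeries_energy hθ
  have h0 : oddSeries (fun i => (2 * i + 1) * cschOdd θ i) 0 = jacobiSeriesDeriv θ 0 := by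
    rw [← oddSeries_odd_mul_cschOdd_mul_I]; simp
  rw [h0] at h2
  refine ⟨κ, fun x => ?_, fun x => ?_, h2⟩
  · have h := hasDerivAt_mul_I
      ((stripSummable_cschOdd hθ).odd_mul.hasDerivAt (mul_I_mem_strip hθ x))
    rw [h1 _ (mul_I_mem_strip hθ x), oddSeries_cschOdd_mul_I] at h
    refine (Complex.reCLM.hasFDerivAt.comp_hasDerivAt x h).congr_deriv ?_
    have : (2 * (jacobiSeries θ x * Complex.I : ℂ) ^ 3 + κ * (jacobiSeries θ x * Complex.I)) *
        Complex.I = ((2 * jacobiSeries θ x ^ 3 - κ * jacobiSeries θ x : ℝ) : ℂ) := by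
      push_cast
      linear_combination (2 * (jacobiSeries θ x : ℂ) ^ 3 * (Complex.I ^ 2 - 1) +
        κ * jacobiSeries θ x) * Complex.I_sq
    rw [this]
    exact Complex.ofReal_re _
  · have h := h2 _ (mul_I_mem_strip hθ x)
    rw [oddSeries_cschOdd_mul_I, oddSeries_odd_mul_cschOdd_mul_I] at h
    have h3 : (jacobiSeriesDeriv θ x : ℂ) ^ 2 = ((jacobiSeries θ x ^ 4 - κ * jacobiSeries θ x ^ 2 +
        jacobiSeriesDeriv θ 0 ^ 2 : ℝ) : ℂ) := by
      rw [h]; push_cast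
      linear_combination ((jacobiSeries θ x : ℂ) ^ 4 * (Complex.I ^ 2 - 1) +
        κ * jacobiSeries θ x ^ 2) * Complex.I_sq
    exact_mod_cast h3

theorem jacobiSeries_neg (θ x : ℝ) : jacobiSeries θ (-x) = -jacobiSeries θ x := by
  rw [jacobiSeries, jacobiSeries, ← Complex.neg_im, ← oddSeries_neg_of_odd (cschOdd_neg θ)]
  push_cast; rw [neg_mul]

theorem jacobiSeriesDeriv_neg (θ x : ℝ) : jacobiSeriesDeriv θ (-x) = jacobiSeriesDeriv θ x := by
  rw [jacobiSeriesDeriv, jacobiSeriesDeriv, ← oddSeries_neg_of_even (odd_mul_cschOdd_neg θ) (x * _)]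
  push_cast; rw [neg_mul]

theorem jacobiSeries_zero (θ : ℝ) : jacobiSeries θ 0 = 0 := by
  have := jacobiSeries_neg θ 0
  rw [neg_zero] at this; linarith

theorem oddSeries_add_pi_mul_I (c : ℤ → ℝ) (w : ℂ) :
    oddSeries c (w + Real.pi * Complex.I) = -oddSeries c w := by
  rw [oddSeries, oddSeries, ← tsum_neg]
  refine tsum_congr fun i => ?_
  rw [show (2 * i + 1 : ℂ) * (w + Real.pi * Complex.I) =
    (2 * i + 1) * w + Real.pi * Complex.I + i * (2 * Real.pi * Complex.I) by ring,
    Complex.exp_add, Complex.exp_add, Complex.exp_pi_mul_I, Complex.exp_int_mul_two_pi_mul_I]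
  ring

theorem jacobiSeries_add_pi (θ x : ℝ) : jacobiSeries θ (x + Real.pi) = -jacobiSeries θ x := by
  rw [jacobiSeries, jacobiSeries, ← Complex.neg_im, ← oddSeries_add_pi_mul_I]
  push_cast; rw [add_mul]

theorem jacobiSeriesDeriv_add_pi (θ x : ℝ) :
    jacobiSeriesDeriv θ (x + Real.pi) = -jacobiSeriesDeriv θ x := by
  rw [jacobiSeriesDeriv, jacobiSeriesDeriv, ← Complex.neg_re, ← oddSeries_add_pi_mul_I]
  push_cast; rw [add_mul]

theorem jacobiSeries_pi_sub (θ x : ℝ) : jacobiSeries θ (Real.pi - x) = jacobiSeries θ x := by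
  rw [show Real.pi - x = -x + Real.pi by ring, jacobiSeries_add_pi, jacobiSeries_neg, neg_neg]

theorem jacobiSeries_add_int_mul_two_pi (θ x : ℝ) (k : ℤ) :
    jacobiSeries θ (x + k * (2 * Real.pi)) = jacobiSeries θ x := by
  have h : Function.Periodic (jacobiSeries θ) (2 * Real.pi) := fun y => by
    rw [show y + 2 * Real.pi = y + Real.pi + Real.pi by ring, jacobiSeries_add_pi,
      jacobiSeries_add_pi, neg_neg]
  exact h.int_mul k x

theorem jacobiSeriesDeriv_pi_div_two (θ : ℝ) : jacobiSeriesDeriv θ (Real.pi / 2) = 0 := by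
  have h := jacobiSeriesDeriv_add_pi θ (-(Real.pi / 2))
  rw [jacobiSeriesDeriv_neg, show -(Real.pi / 2) + Real.pi = Real.pi / 2 by ring] at h
  linarith

theorem cschOdd_pos {θ : ℝ} (hθ : 0 < θ) (l : ℕ) : 0 < cschOdd θ l := by
  rw [cschOdd, inv_pos, Real.sinh_pos_iff]
  push_cast; positivity

theorem odd_mul_cschOdd_pos {θ : ℝ} (hθ : 0 < θ) (i : ℤ) : 0 < (2 * i + 1) * cschOdd θ i := by
  rcases le_or_gt 0 i with h | h
  · obtain ⟨l, rfl⟩ := Int.eq_ofNat_of_zero_le h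
    have := cschOdd_pos hθ l
    push_cast; positivity
  · obtain ⟨l, hl⟩ := Int.eq_ofNat_of_zero_le (show 0 ≤ -1 - i by omega)
    rw [← odd_mul_cschOdd_neg, hl]
    have := cschOdd_pos hθ l
    push_cast; positivity

/-- The sine series of `jacobiSeries`. -/
theorem hasSum_jacobiSeries {θ : ℝ} (hθ : 0 < θ) (x : ℝ) :
    HasSum (fun l : ℕ => 2 * cschOdd θ l * Real.sin ((2 * l + 1) * x)) (jacobiSeries θ x) := by
  have h := (stripSummable_cschOdd hθ).hasSum (mul_I_mem_strip hθ x)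
  have h1 := (Complex.hasSum_im h).of_eq (g := fun i : ℤ => cschOdd θ i * Real.sin ((2 * i + 1) * x))
    (fun i => ?_) rfl
  · refine h1.nat_add_neg_add_one.of_eq (fun l => ?_) rfl
    rw [show (-((l : ℤ) + 1)) = -1 - (l : ℤ) by ring, cschOdd_neg]
    have : (2 * ((-1 - (l : ℤ) : ℤ) : ℝ) + 1) * x = -((2 * l + 1) * x) := by push_cast; ring
    rw [this, Real.sin_neg]
    push_cast; ring
  · rw [show (2 * i + 1 : ℂ) * (x * Complex.I) = ((2 * i + 1) * x : ℝ) * Complex.I by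
      push_cast; ring, Complex.im_ofReal_mul, Complex.exp_ofReal_mul_I_im]

theorem abs_jacobiSeries_le {θ : ℝ} (hθ : 0 < θ) (x : ℝ) :
    |jacobiSeries θ x| ≤ ∑' i, |cschOdd θ i| := by
  refine (Complex.abs_im_le_norm _).trans ?_
  have h := (stripSummable_cschOdd hθ).summable_norm (mul_I_mem_strip hθ x)
  refine (norm_tsum_le_tsum_norm h).trans (h.tsum_le_tsum (fun i => ?_) (summable_abs_cschOdd hθ))
  simpa using norm_oddSeries_term_le (cschOdd θ) i (w := x * Complex.I) (ρ := 0) (by simp)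

theorem jacobiSeriesDeriv_zero_pos {θ : ℝ} (hθ : 0 < θ) : 0 < jacobiSeriesDeriv θ 0 := by
  have h := (stripSummable_cschOdd hθ).odd_mul.hasSum (mul_I_mem_strip hθ 0)
  rw [oddSeries_odd_mul_cschOdd_mul_I] at h
  have h1 : HasSum (fun i : ℤ => (2 * i + 1) * cschOdd θ i) (jacobiSeriesDeriv θ 0) := by
    have := Complex.hasSum_re h
    simpa using this
  rw [← h1.tsum_eq]
  exact h1.summable.tsum_pos (fun i => (odd_mul_cschOdd_pos hθ i).le) 0 (odd_mul_cschOdd_pos hθ 0)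

theorem continuous_jacobiSeries {θ : ℝ} (hθ : 0 < θ) : Continuous (jacobiSeries θ) :=
  continuous_iff_continuousAt.2 fun x => (hasDerivAt_jacobiSeries hθ x).continuousAt

/-! ### Sine integrals -/

theorem integral_sin_mul_sin (m k : ℕ+) :
    ∫ x in (0 : ℝ)..1, Real.sin (m * Real.pi * x) * Real.sin (k * Real.pi * x) =
      if m = k then 1 / 2 else 0 := by
  have hc : ∀ a : ℤ, ∫ x in (0 : ℝ)..1, Real.cos (a * Real.pi * x) = if a = 0 then 1 else 0 := by
    intro a
    split_ifs with h
    · simp [h]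
    · have ha : (a * Real.pi : ℝ) ≠ 0 := mul_ne_zero (by exact_mod_cast h) Real.pi_ne_zero
      rw [intervalIntegral.integral_comp_mul_left (fun y => Real.cos y) ha, integral_cos]
      simp [Real.sin_int_mul_pi]
  have h1 : ∀ x : ℝ, Real.sin (m * Real.pi * x) * Real.sin (k * Real.pi * x) =
      (Real.cos (((m : ℤ) - k : ℤ) * Real.pi * x) -
        Real.cos (((m : ℤ) + k : ℤ) * Real.pi * x)) / 2 := by
    intro x
    have e1 : (((m : ℤ) - k : ℤ) : ℝ) * Real.pi * x = m * Real.pi * x - k * Real.pi * x := by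
      push_cast; ring
    have e2 : (((m : ℤ) + k : ℤ) : ℝ) * Real.pi * x = m * Real.pi * x + k * Real.pi * x := by
      push_cast; ring
    rw [e1, e2, Real.cos_sub, Real.cos_add]; ring
  simp only [h1]
  rw [intervalIntegral.integral_div, intervalIntegral.integral_sub
    (Continuous.intervalIntegrable (by fun_prop) _ _)
    (Continuous.intervalIntegrable (by fun_prop) _ _), hc, hc]
  have h2 : ((m : ℤ) + k : ℤ) ≠ 0 := by have := m.pos; have := k.pos; omega
  have h3 : ((m : ℤ) - k : ℤ) = 0 ↔ m = k := by
    rw [sub_eq_zero]; exact_mod_cast Iff.rfl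
  rw [if_neg h2]
  simp only [h3]
  split_ifs <;> norm_num

/-- The odd number `2l+1` as a positive natural number. -/
def oddPNat (l : ℕ) : ℕ+ := ⟨2 * l + 1, by omega⟩

@[simp] theorem oddPNat_coe (l : ℕ) : ((oddPNat l : ℕ+) : ℕ) = 2 * l + 1 := rfl

theorem oddPNat_zero : oddPNat 0 = 1 := rfl

theorem oddPNat_injective : Function.Injective oddPNat := by
  intro a b h
  have : 2 * a + 1 = 2 * b + 1 := congrArg PNat.val h
  omega

theorem hasSum_integral_jacobiSeries {θ : ℝ} (hθ : 0 < θ) (n k : ℕ+) :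
    HasSum (fun l : ℕ => cschOdd θ l * if oddPNat l * n = k then 1 else 0)
      (∫ x in (0 : ℝ)..1, jacobiSeries θ (n * Real.pi * x) * Real.sin (k * Real.pi * x)) := by
  have hs : Summable fun l : ℕ => |cschOdd θ l| :=
    (summable_abs_cschOdd hθ).comp_injective (i := fun l : ℕ => (l : ℤ)) Nat.cast_injective
  have h : HasSum (fun l : ℕ => ∫ x in (0 : ℝ)..1,
      2 * cschOdd θ l * Real.sin ((2 * l + 1) * (n * Real.pi * x)) * Real.sin (k * Real.pi * x))
      (∫ x in (0 : ℝ)..1, jacobiSeries θ (n * Real.pi * x) * Real.sin (k * Real.pi * x)) := by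
    refine intervalIntegral.hasSum_integral_of_dominated_convergence
      (fun l _ => 2 * |cschOdd θ l|) (fun l => Continuous.aestronglyMeasurable (by fun_prop))
      (fun l => Eventually.of_forall fun x _ => ?_) (Eventually.of_forall fun x _ => hs.mul_left 2)
      intervalIntegrable_const
      (Eventually.of_forall fun x _ => (hasSum_jacobiSeries hθ _).mul_right _)
    rw [norm_mul, norm_mul, norm_mul]
    simp only [Real.norm_eq_abs, abs_two]
    have h1 := Real.abs_sin_le_one ((2 * l + 1) * (n * Real.pi * x))
    have h2 := Real.abs_sin_le_one (k * Real.pi * x)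
    calc _ ≤ 2 * |cschOdd θ l| * 1 * 1 := by gcongr
      _ = _ := by ring
  refine h.of_eq (fun l => ?_) rfl
  have : ∀ x : ℝ, 2 * cschOdd θ l * Real.sin ((2 * l + 1) * (n * Real.pi * x)) *
      Real.sin (k * Real.pi * x) = 2 * cschOdd θ l *
        (Real.sin ((oddPNat l * n : ℕ+) * Real.pi * x) * Real.sin (k * Real.pi * x)) := by
    intro x
    push_cast [PNat.mul_coe, oddPNat_coe]
    rw [← mul_assoc]
    ring_nf
  simp only [this]
  rw [intervalIntegral.integral_const_mul, integral_sin_mul_sin]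
  split_ifs <;> ring

/-! ### Monotonicity up to the quarter period -/

/-- Uniqueness for `D'' = g D` with bounded `g`. -/
theorem eq_zero_of_linear_ode {D D' g : ℝ → ℝ} {C : ℝ} (hg : ∀ x, |g x| ≤ C)
    (h1 : ∀ x, HasDerivAt D (D' x) x) (h2 : ∀ x, HasDerivAt D' (g x * D x) x) {x₀ : ℝ}
    (h0 : D x₀ = 0) (h0' : D' x₀ = 0) (x : ℝ) : D x = 0 := by
  have hC : 0 ≤ C := (abs_nonneg _).trans (hg 0)
  have hL : ∀ t : ℝ, LipschitzWith (1 + C).toNNReal (fun p : ℝ × ℝ => (p.2, g t * p.1)) := by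
    intro t
    refine LipschitzWith.of_dist_le_mul fun p q => ?_
    rw [Real.coe_toNNReal _ (by linarith), Prod.dist_eq]
    have e1 : dist p.1 q.1 ≤ dist p q := by rw [Prod.dist_eq]; exact le_max_left _ _
    have e2 : dist p.2 q.2 ≤ dist p q := by rw [Prod.dist_eq]; exact le_max_right _ _
    have e3 : 0 ≤ dist p q := dist_nonneg
    refine max_le ?_ ?_
    · nlinarith
    · rw [Real.dist_eq, ← mul_sub, abs_mul, ← Real.dist_eq]
      have := mul_le_mul (hg t) e1 dist_nonneg hC
      nlinarith
  have h := ODE_solution_unique_univ (v := fun t (p : ℝ × ℝ) => (p.2, g t * p.1))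
    (s := fun _ => univ) (f := fun x => (D x, D' x)) (g := fun _ => (0, 0)) (t₀ := x₀)
    (fun t => (hL t).lipschitzOnWith)
    (fun t => ⟨(h1 t).prodMk (h2 t), mem_univ _⟩)
    (fun t => ⟨(hasDerivAt_const t ((0 : ℝ), (0 : ℝ))).congr_deriv (by simp [Prod.ext_iff]), mem_univ _⟩)
    (by simp [h0, h0'])
  exact congrArg Prod.fst (congrFun h x)

/-- The first Fourier coefficient rules out periods that are not multiples of `2π`. -/
theorem not_periodic_jacobiSeries {θ : ℝ} (hθ : 0 < θ) {T : ℝ} (hT : Real.cos T ≠ 1) :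
    ¬ Function.Periodic (jacobiSeries θ) T := by
  intro hp
  set J : ℝ → ℝ := fun a => ∫ x in (0 : ℝ)..Real.pi, jacobiSeries θ x * Real.sin (x + a) with hJ
  have hc := continuous_jacobiSeries hθ
  have hper : ∀ a b : ℝ, Function.Periodic (fun x => jacobiSeries θ (x + b) * Real.sin (x + a))
      Real.pi := by
    intro a b x
    simp only
    rw [show x + Real.pi + b = x + b + Real.pi by ring, jacobiSeries_add_pi,
      show x + Real.pi + a = x + a + Real.pi by ring, Real.sin_add_pi, neg_mul_neg]
  have hJT : ∀ S, Function.Periodic (jacobiSeries θ) S → J (-S) = J 0 := by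
    intro S hS
    have h1 := (hper (-S) 0).intervalIntegral_add_eq 0 S
    simp only [add_zero, zero_add] at h1
    have h2 := intervalIntegral.integral_comp_add_right (a := 0) (b := Real.pi)
      (fun x => jacobiSeries θ x * Real.sin (x + -S)) S
    rw [zero_add, add_comm Real.pi S, ← h1] at h2
    rw [hJ]
    dsimp only
    rw [← h2]
    refine intervalIntegral.integral_congr fun x _ => ?_
    rw [hS, add_neg_cancel_right, add_zero]
  have h1 := hJT T hp
  have h2 := hJT (-T) hp.neg
  rw [neg_neg] at h2
  have h3 : J T + J (-T) = 2 * Real.cos T * J 0 := by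
    rw [hJ]
    dsimp only
    rw [← intervalIntegral.integral_add (Continuous.intervalIntegrable (by fun_prop) _ _)
      (Continuous.intervalIntegrable (by fun_prop) _ _), ← intervalIntegral.integral_const_mul]
    refine intervalIntegral.integral_congr fun x _ => ?_
    rw [Real.sin_add, Real.sin_add, Real.cos_neg, Real.sin_neg, add_zero]
    ring
  have h4 : J 0 ≠ 0 := by
    have h := hasSum_integral_jacobiSeries hθ 1 1
    have h5 := h.unique (hasSum_single 0 fun l hl => by
      rw [if_neg, mul_zero]
      intro h
      rw [mul_one] at h
      exact hl (oddPNat_injective h))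
    have h6 := intervalIntegral.integral_comp_mul_left (a := 0) (b := 1)
      (fun x => jacobiSeries θ x * Real.sin x) Real.pi_ne_zero
    simp only [PNat.one_coe, Nat.cast_one, one_mul, mul_zero, mul_one] at h5 h6
    rw [h5, if_pos oddPNat_zero, mul_one, smul_eq_mul] at h6
    have := cschOdd_pos hθ 0
    simp only [hJ, add_zero]
    intro h7
    rw [h7, mul_zero] at h6
    exact this.ne' h6
  apply hT
  have : (Real.cos T - 1) * J 0 = 0 := by linarith
  rcases mul_eq_zero.1 this with h | h
  · linarith
  · exact absurd h h4

/-- A critical point of `jacobiSeries` is a symmetry centre, so one inside `(-π/2, π/2)` would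
produce too short a period. -/
theorem jacobiSeriesDeriv_ne_zero {θ : ℝ} (hθ : 0 < θ) {x₀ : ℝ}
    (hx : x₀ ∈ Ioo (-(Real.pi / 2)) (Real.pi / 2)) : jacobiSeriesDeriv θ x₀ ≠ 0 := by
  intro h0
  obtain ⟨κ, hode, -, -⟩ := exists_jacobiSeries_ode hθ
  set B := ∑' i, |cschOdd θ i| with hB
  have hs := abs_jacobiSeries_le hθ
  have hsym : ∀ x, jacobiSeries θ (2 * x₀ - x) = jacobiSeries θ x := by
    intro x
    rw [← sub_eq_zero]
    refine eq_zero_of_linear_ode (D := fun x => jacobiSeries θ (2 * x₀ - x) - jacobiSeries θ x)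
      (D' := fun x => -jacobiSeriesDeriv θ (2 * x₀ - x) - jacobiSeriesDeriv θ x)
      (g := fun x => 2 * (jacobiSeries θ (2 * x₀ - x) ^ 2 +
        jacobiSeries θ (2 * x₀ - x) * jacobiSeries θ x + jacobiSeries θ x ^ 2) - κ)
      (C := 6 * B ^ 2 + |κ|) (x₀ := x₀) (fun x => ?_) (fun x => ?_) (fun x => ?_) ?_ ?_ x
    · have ha := abs_le.1 (hs (2 * x₀ - x))
      have hb := abs_le.1 (hs x)
      rw [← hB] at ha hb
      have := abs_le.1 (le_refl |κ|)
      rw [abs_le]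
      constructor <;> nlinarith
    · have h1 : HasDerivAt (fun x : ℝ => 2 * x₀ - x) (-1) x := by
        simpa using (hasDerivAt_id x).const_sub (2 * x₀)
      refine (((hasDerivAt_jacobiSeries hθ _).comp x h1).sub
        (hasDerivAt_jacobiSeries hθ x)).congr_deriv ?_
      ring
    · have h1 : HasDerivAt (fun x : ℝ => 2 * x₀ - x) (-1) x := by
        simpa using (hasDerivAt_id x).const_sub (2 * x₀)
      refine (((hode _).comp x h1).neg.sub (hode x)).congr_deriv ?_
      ring
    · ring_nf
    · rw [show 2 * x₀ - x₀ = x₀ by ring, h0]; ring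
  refine not_periodic_jacobiSeries hθ (T := Real.pi - 2 * x₀) ?_ fun x => ?_
  · intro h
    have h1 : 0 < Real.pi - 2 * x₀ := by linarith [hx.2]
    have h2 : Real.pi - 2 * x₀ < 2 * Real.pi := by linarith [hx.1]
    rw [Real.cos_eq_one_iff_of_lt_of_lt (by linarith [Real.pi_pos]) h2] at h
    linarith
  · rw [show x + (Real.pi - 2 * x₀) = Real.pi - (2 * x₀ - x) by ring, jacobiSeries_pi_sub, hsym]

theorem jacobiSeriesDeriv_pos {θ : ℝ} (hθ : 0 < θ) {x : ℝ}
    (hx : x ∈ Ioo (-(Real.pi / 2)) (Real.pi / 2)) : 0 < jacobiSeriesDeriv θ x := by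
  obtain ⟨κ, hode, -, -⟩ := exists_jacobiSeries_ode hθ
  have hc : Continuous (jacobiSeriesDeriv θ) :=
    continuous_iff_continuousAt.2 fun x => (hode x).continuousAt
  by_contra! h
  have h0 : (0 : ℝ) ∈ Ioo (-(Real.pi / 2)) (Real.pi / 2) := by
    constructor <;> linarith [Real.pi_pos]
  obtain ⟨y, hy, hy0⟩ := isPreconnected_Ioo.intermediate_value hx h0 hc.continuousOn
    ⟨h, (jacobiSeriesDeriv_zero_pos hθ).le⟩
  exact jacobiSeriesDeriv_ne_zero hθ hy hy0

theorem strictMonoOn_jacobiSeries {θ : ℝ} (hθ : 0 < θ) :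
    StrictMonoOn (jacobiSeries θ) (Icc (-(Real.pi / 2)) (Real.pi / 2)) := by
  refine strictMonoOn_of_deriv_pos (convex_Icc _ _) (continuous_jacobiSeries hθ).continuousOn
    fun x hx => ?_
  rw [interior_Icc] at hx
  rw [(hasDerivAt_jacobiSeries hθ x).deriv]
  exact jacobiSeriesDeriv_pos hθ hx

/-- The first integral in factored form. The amplitude `M` is the value at the quarter period
`π/2`, and `M / lam` will be the modulus. -/
theorem exists_jacobiSeries_factor {θ : ℝ} (hθ : 0 < θ) : ∃ M lam : ℝ, 0 < M ∧ M < lam ∧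
    jacobiSeries θ (Real.pi / 2) = M ∧
    (∀ x, HasDerivAt (jacobiSeriesDeriv θ)
      (jacobiSeries θ x * (2 * jacobiSeries θ x ^ 2 - M ^ 2 - lam ^ 2)) x) ∧
    (∀ x, jacobiSeriesDeriv θ x ^ 2 =
      (M ^ 2 - jacobiSeries θ x ^ 2) * (lam ^ 2 - jacobiSeries θ x ^ 2)) ∧
    ∀ w ∈ strip θ, oddSeries (fun i => (2 * i + 1) * cschOdd θ i) w ^ 2 =
      (oddSeries (cschOdd θ) w ^ 2 + M ^ 2) * (oddSeries (cschOdd θ) w ^ 2 + lam ^ 2) := by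
  obtain ⟨κ, hode, hen, hstrip⟩ := exists_jacobiSeries_ode hθ
  have hpi := Real.pi_pos
  have hmono := strictMonoOn_jacobiSeries hθ
  set M := jacobiSeries θ (Real.pi / 2) with hM
  have hM0 : 0 < M := by
    rw [← jacobiSeries_zero θ]
    exact hmono (by constructor <;> linarith) (by constructor <;> linarith) (by linarith)
  set E := jacobiSeriesDeriv θ 0 with hE
  have hE0 : 0 < E := jacobiSeriesDeriv_zero_pos hθ
  set lam := E / M with hlam
  have hlam0 : 0 < lam := by positivity
  have hEM : E = lam * M := by rw [hlam]; field_simp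
  have hκ : κ = M ^ 2 + lam ^ 2 := by
    have h := hen (Real.pi / 2)
    rw [jacobiSeriesDeriv_pi_div_two, ← hM, hEM] at h
    have h1 : (κ - (M ^ 2 + lam ^ 2)) * M ^ 2 = 0 := by linarith
    rcases mul_eq_zero.1 h1 with h | h
    · linarith
    · exact absurd h (by positivity)
  have hfac : ∀ x, jacobiSeriesDeriv θ x ^ 2 =
      (M ^ 2 - jacobiSeries θ x ^ 2) * (lam ^ 2 - jacobiSeries θ x ^ 2) := by
    intro x
    rw [hen, hκ, hEM]; ring
  have hode' : ∀ x, HasDerivAt (jacobiSeriesDeriv θ)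
      (jacobiSeries θ x * (2 * jacobiSeries θ x ^ 2 - M ^ 2 - lam ^ 2)) x := by
    intro x
    refine (hode x).congr_deriv ?_
    rw [hκ]; ring
  refine ⟨M, lam, hM0, ?_, rfl, hode', hfac, fun w hw => ?_⟩
  · have hle : M ≤ lam := by
      by_contra! hlt
      -- at a point where the series takes the value `lam < M` its derivative would vanish
      obtain ⟨x, hx, hxl⟩ := intermediate_value_Icc (show (0 : ℝ) ≤ Real.pi / 2 by linarith)
        (continuous_jacobiSeries hθ).continuousOn
        (show lam ∈ Icc (jacobiSeries θ 0) (jacobiSeries θ (Real.pi / 2)) by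
          rw [jacobiSeries_zero]; exact ⟨hlam0.le, hlt.le⟩)
      have hx2 : x ≠ Real.pi / 2 := by
        rintro rfl
        exact hlt.ne hxl.symm
      have h1 := jacobiSeriesDeriv_pos hθ
        (x := x) ⟨by linarith [hx.1], lt_of_le_of_ne hx.2 hx2⟩
      have h2 := hfac x
      rw [hxl, sub_self, mul_zero] at h2
      nlinarith
    refine lt_of_le_of_ne hle fun heq => ?_
    -- if the roots coincide, the constant `M` solves the same initial value problem at `π/2`
    have h := eq_zero_of_linear_ode (D := fun x => jacobiSeries θ x - M)
      (D' := jacobiSeriesDeriv θ)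
      (g := fun x => 2 * jacobiSeries θ x * (jacobiSeries θ x + M))
      (C := 2 * (∑' i, |cschOdd θ i|) * (∑' i, |cschOdd θ i| + M)) (x₀ := Real.pi / 2)
      (fun x => ?_) (fun x => (hasDerivAt_jacobiSeries hθ x).sub_const M)
      (fun x => (hode' x).congr_deriv (by rw [← heq]; ring)) (by simp [hM])
      (jacobiSeriesDeriv_pi_div_two θ) 0
    · rw [jacobiSeries_zero] at h
      linarith
    · have h1 := abs_jacobiSeries_le hθ x
      have h2 : |jacobiSeries θ x + M| ≤ ∑' i, |cschOdd θ i| + M :=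
        (abs_add_le _ _).trans (add_le_add h1 (abs_of_pos hM0).le)
      rw [abs_mul, abs_mul, abs_two]
      gcongr
  · rw [hstrip w hw, hκ, hEM]; push_cast; ring

/-! ### Elliptic integrals -/

/-- The integrand of `ellipticW`. -/
def ellipticIntegrand (μ t : ℝ) : ℝ :=
  (1 - t ^ 2) ^ (-(1 / 2) : ℝ) * (1 - μ ^ 2 * t ^ 2) ^ (-(1 / 2) : ℝ)

theorem one_sub_sq_mul_sq_pos {μ t : ℝ} (hμ : μ ∈ Ioo (0 : ℝ) 1) (ht : t ∈ Icc (-1 : ℝ) 1) :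
    0 < 1 - μ ^ 2 * t ^ 2 := by
  have h1 : t ^ 2 ≤ 1 := by nlinarith [ht.1, ht.2]
  have h2 : μ ^ 2 < 1 := by nlinarith [hμ.1, hμ.2]
  nlinarith [sq_nonneg t, sq_nonneg μ]

theorem one_sub_sq_pos {t : ℝ} (ht : t ∈ Ioo (-1 : ℝ) 1) : 0 < 1 - t ^ 2 := by
  nlinarith [ht.1, ht.2]

theorem ellipticIntegrand_pos {μ t : ℝ} (hμ : μ ∈ Ioo (0 : ℝ) 1) (ht : t ∈ Ioo (-1 : ℝ) 1) :
    0 < ellipticIntegrand μ t :=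
  mul_pos (Real.rpow_pos_of_pos (one_sub_sq_pos ht) _)
    (Real.rpow_pos_of_pos (one_sub_sq_mul_sq_pos hμ (Ioo_subset_Icc_self ht)) _)

theorem continuousOn_ellipticIntegrand {μ : ℝ} (hμ : μ ∈ Ioo (0 : ℝ) 1) :
    ContinuousOn (ellipticIntegrand μ) (Ioo (-1) 1) := by
  refine ContinuousOn.mul ?_ ?_
  · exact ContinuousOn.rpow_const (by fun_prop) fun t ht => Or.inl (one_sub_sq_pos ht).ne'
  · exact ContinuousOn.rpow_const (by fun_prop) fun t ht =>
      Or.inl (one_sub_sq_mul_sq_pos hμ (Ioo_subset_Icc_self ht)).ne'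

theorem intervalIntegrable_ellipticIntegrand {μ : ℝ} (hμ : μ ∈ Ioo (0 : ℝ) 1) :
    IntervalIntegrable (ellipticIntegrand μ) volume (-1) 1 := by
  -- the first factor is the derivative of `arcsin`, the second one is bounded
  have h1 : IntervalIntegrable (fun t : ℝ => (1 - t ^ 2) ^ (-(1 / 2) : ℝ)) volume (-1) 1 := by
    refine intervalIntegral.intervalIntegrable_deriv_of_nonneg
      (g := Real.arcsin) Real.continuous_arcsin.continuousOn (fun t ht => ?_) (fun t ht => ?_)
    · rw [min_eq_left (by norm_num), max_eq_right (by norm_num)] at ht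
      refine (Real.hasDerivAt_arcsin ht.1.ne' ht.2.ne).congr_deriv ?_
      rw [Real.rpow_neg (one_sub_sq_pos ht).le, ← Real.sqrt_eq_rpow, one_div]
    · rw [min_eq_left (by norm_num), max_eq_right (by norm_num)] at ht
      exact Real.rpow_nonneg (one_sub_sq_pos ht).le _
  refine h1.mul_continuousOn ?_
  rw [uIcc_of_le (by norm_num)]
  exact ContinuousOn.rpow_const (by fun_prop) fun t ht =>
    Or.inl (one_sub_sq_mul_sq_pos hμ ht).ne'

theorem intervalIntegrable_ellipticIntegrand_sub {μ a b : ℝ} (hμ : μ ∈ Ioo (0 : ℝ) 1)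
    (ha : a ∈ Icc (-1 : ℝ) 1) (hb : b ∈ Icc (-1 : ℝ) 1) :
    IntervalIntegrable (ellipticIntegrand μ) volume a b := by
  refine (intervalIntegrable_ellipticIntegrand hμ).mono_set ?_
  rw [uIcc_of_le (show (-1 : ℝ) ≤ 1 by norm_num)]
  exact uIcc_subset_Icc ha hb

theorem continuousOn_ellipticW {μ : ℝ} (hμ : μ ∈ Ioo (0 : ℝ) 1) :
    ContinuousOn (ellipticW μ) (Icc (-1) 1) := by
  have := intervalIntegral.continuousOn_primitive_interval' (a := 0)
    (intervalIntegrable_ellipticIntegrand hμ) (by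
      rw [uIcc_of_le (by norm_num)]; constructor <;> norm_num)
  rwa [uIcc_of_le (by norm_num)] at this

theorem hasDerivAt_ellipticW {μ z : ℝ} (hμ : μ ∈ Ioo (0 : ℝ) 1) (hz : z ∈ Ioo (-1 : ℝ) 1) :
    HasDerivAt (ellipticW μ) (ellipticIntegrand μ z) z := by
  have hc := continuousOn_ellipticIntegrand hμ
  refine intervalIntegral.integral_hasDerivAt_right
    (intervalIntegrable_ellipticIntegrand_sub hμ (by constructor <;> norm_num)
      (Ioo_subset_Icc_self hz))
    (hc.stronglyMeasurableAtFilter isOpen_Ioo z hz) (hc.continuousAt (isOpen_Ioo.mem_nhds hz))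

theorem strictMonoOn_ellipticW {μ : ℝ} (hμ : μ ∈ Ioo (0 : ℝ) 1) :
    StrictMonoOn (ellipticW μ) (Icc (-1) 1) := by
  refine strictMonoOn_of_deriv_pos (convex_Icc _ _) (continuousOn_ellipticW hμ) fun x hx => ?_
  rw [interior_Icc] at hx
  rw [(hasDerivAt_ellipticW hμ hx).deriv]
  exact ellipticIntegrand_pos hμ hx

theorem ellipticK_pos {μ : ℝ} (hμ : μ ∈ Ioo (0 : ℝ) 1) : 0 < ellipticK μ := by
  have h : ellipticW μ 0 = 0 := intervalIntegral.integral_same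
  rw [ellipticK, ← h]
  exact strictMonoOn_ellipticW hμ (by constructor <;> norm_num) (by constructor <;> norm_num)
    (by norm_num)

theorem strictMonoOn_ellipticK : StrictMonoOn ellipticK (Ioo 0 1) := by
  intro μ hμ ν hν h
  have i1 := intervalIntegrable_ellipticIntegrand_sub hμ (a := 0) (b := 1)
    (by constructor <;> norm_num) (by constructor <;> norm_num)
  have i2 := intervalIntegrable_ellipticIntegrand_sub hν (a := 0) (b := 1)
    (by constructor <;> norm_num) (by constructor <;> norm_num)
  have h1 := intervalIntegral.intervalIntegral_pos_of_pos_on (i2.sub i1) (fun t ht => ?_)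
    (by norm_num)
  · rw [intervalIntegral.integral_sub i2 i1] at h1
    exact sub_pos.1 h1
  · have ht' : t ∈ Ioo (-1 : ℝ) 1 := ⟨by linarith [ht.1], ht.2⟩
    rw [sub_pos]
    refine mul_lt_mul_of_pos_left ?_ (Real.rpow_pos_of_pos (one_sub_sq_pos ht') _)
    refine Real.rpow_lt_rpow_of_neg (one_sub_sq_mul_sq_pos hν (Ioo_subset_Icc_self ht')) ?_
      (by norm_num)
    have h2 : μ ^ 2 < ν ^ 2 := by nlinarith [hμ.1]
    have h3 : 0 < t ^ 2 := by nlinarith [ht.1]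
    nlinarith

theorem sqrt_one_sub_sq_mem {μ : ℝ} (hμ : μ ∈ Ioo (0 : ℝ) 1) : √(1 - μ ^ 2) ∈ Ioo (0 : ℝ) 1 := by
  constructor
  · exact Real.sqrt_pos.2 (by nlinarith [hμ.1, hμ.2])
  · rw [Real.sqrt_lt' one_pos]
    nlinarith [hμ.1]

theorem nome_mem {μ : ℝ} (hμ : μ ∈ Ioo (0 : ℝ) 1) : nome μ ∈ Ioo (0 : ℝ) 1 := by
  refine ⟨Real.exp_pos _, ?_⟩
  rw [nome, Real.exp_lt_one_iff, neg_lt_zero]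
  exact div_pos (mul_pos Real.pi_pos (ellipticK_pos (sqrt_one_sub_sq_mem hμ))) (ellipticK_pos hμ)

theorem strictMonoOn_nome : StrictMonoOn nome (Ioo 0 1) := by
  intro μ hμ ν hν h
  have hμ' := sqrt_one_sub_sq_mem hμ
  have hν' := sqrt_one_sub_sq_mem hν
  have h1 : √(1 - ν ^ 2) < √(1 - μ ^ 2) :=
    Real.sqrt_lt_sqrt (by nlinarith [hν.1, hν.2]) (by nlinarith [hμ.1])
  have h2 := strictMonoOn_ellipticK hμ hν h
  have h3 := strictMonoOn_ellipticK hν' hμ' h1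
  have h4 := ellipticK_pos hμ
  have h5 := ellipticK_pos hν'
  rw [nome, nome, Real.exp_lt_exp, neg_lt_neg_iff]
  have hpi := Real.pi_pos
  exact div_lt_div₀ (mul_lt_mul_of_pos_left h3 hpi) h2.le (by nlinarith) h4

/-- A solution of `φ' = lam √((1-φ²)(1-μ²φ²))` with `φ(0) = 0` is inverse to `ellipticW μ`, up to
the scaling by `lam`. -/
theorem ellipticW_comp_eq {μ lam a b : ℝ} {φ φ' : ℝ → ℝ} (hμ : μ ∈ Ioo (0 : ℝ) 1) (hlam : 0 < lam)
    (h0 : (0 : ℝ) ∈ Ioo a b) (hφ0 : φ 0 = 0) (hφ : ∀ x ∈ Ioo a b, HasDerivAt φ (φ' x) x)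
    (hφ1 : ∀ x ∈ Ioo a b, φ x ∈ Ioo (-1 : ℝ) 1) (hpos : ∀ x ∈ Ioo a b, 0 < φ' x)
    (heq : ∀ x ∈ Ioo a b, φ' x ^ 2 = lam ^ 2 * ((1 - φ x ^ 2) * (1 - μ ^ 2 * φ x ^ 2)))
    {x : ℝ} (hx : x ∈ Ioo a b) : ellipticW μ (φ x) = lam * x := by
  have hd : ∀ x ∈ Ioo a b, HasDerivAt (fun x => ellipticW μ (φ x) - lam * x) 0 x := by
    intro x hx
    have h1 := (hasDerivAt_ellipticW hμ (hφ1 x hx)).comp x (hφ x hx)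
    refine (h1.sub ((hasDerivAt_id x).const_mul lam)).congr_deriv ?_
    have p1 := one_sub_sq_pos (hφ1 x hx)
    have p2 := one_sub_sq_mul_sq_pos hμ (Ioo_subset_Icc_self (hφ1 x hx))
    have h2 : φ' x = lam * (√(1 - φ x ^ 2) * √(1 - μ ^ 2 * φ x ^ 2)) := by
      refine (pow_left_inj₀ (hpos x hx).le (by positivity) two_ne_zero).1 ?_
      rw [heq x hx, mul_pow, mul_pow, Real.sq_sqrt p1.le, Real.sq_sqrt p2.le]
    rw [h2, ellipticIntegrand, Real.rpow_neg p1.le, Real.rpow_neg p2.le, ← Real.sqrt_eq_rpow,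
      ← Real.sqrt_eq_rpow]
    have q1 := Real.sqrt_pos.2 p1
    have q2 := Real.sqrt_pos.2 p2
    generalize √(1 - φ x ^ 2) = u at *
    generalize √(1 - μ ^ 2 * φ x ^ 2) = v at *
    field_simp
    ring
  have h := isOpen_Ioo.is_const_of_deriv_eq_zero isPreconnected_Ioo
    (fun x hx => (hd x hx).differentiableAt.differentiableWithinAt) (fun x hx => (hd x hx).deriv)
    hx h0
  have h00 : ellipticW μ 0 = 0 := intervalIntegral.integral_same
  simp only [hφ0, h00, mul_zero, sub_zero] at h
  linarith

/-- Passing to the right end point in `ellipticW_comp_eq`. -/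
theorem ellipticK_eq_of_tendsto {μ lam a b : ℝ} {φ : ℝ → ℝ} (hμ : μ ∈ Ioo (0 : ℝ) 1) (hab : a < b)
    (hφ1 : ∀ x ∈ Ioo a b, φ x ∈ Ioo (-1 : ℝ) 1)
    (heq : ∀ x ∈ Ioo a b, ellipticW μ (φ x) = lam * x)
    (hlim : Tendsto φ (𝓝[<] b) (𝓝 1)) : ellipticK μ = lam * b := by
  have hev : ∀ᶠ x in 𝓝[<] b, x ∈ Ioo a b := Ioo_mem_nhdsLT hab
  have h1 : Tendsto φ (𝓝[<] b) (𝓝[Icc (-1) 1] 1) :=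
    tendsto_nhdsWithin_iff.2 ⟨hlim, hev.mono fun x hx => Ioo_subset_Icc_self (hφ1 x hx)⟩
  have h2 := (continuousOn_ellipticW hμ 1 (by constructor <;> norm_num)).tendsto.comp h1
  have h3 : Tendsto (fun x => lam * x) (𝓝[<] b) (𝓝 (lam * b)) :=
    (continuous_const.mul continuous_id).continuousAt.tendsto.mono_left nhdsWithin_le_nhds
  refine tendsto_nhds_unique h2 (h3.congr' ?_)
  filter_upwards [hev] with x hx
  exact (heq x hx).symm

/-! ### The series on the real segment of the strip -/

/-- The series `∑ e^{(2i+1)y} / sinh((2i+1)θ)` on the real axis: up to a factor `i`, this is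
`jacobiSeries` at imaginary arguments. It blows up at `y = θ`, the imaginary half period. -/
def realSeries (θ y : ℝ) : ℝ := (oddSeries (cschOdd θ) y).re

/-- The derivative of `realSeries`. -/
def realSeriesDeriv (θ y : ℝ) : ℝ := (oddSeries (fun i => (2 * i + 1) * cschOdd θ i) y).re

theorem ofReal_mem_strip {θ y : ℝ} (hy : y ∈ Ioo (-θ) θ) : (y : ℂ) ∈ strip θ := by
  simpa [strip, abs_lt] using hy

theorem oddSeries_ofReal (c : ℤ → ℝ) (y : ℝ) : oddSeries c y = ((oddSeries c y).re : ℂ) := by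
  have h := oddSeries_conj c y
  rw [Complex.conj_ofReal] at h
  exact (Complex.conj_eq_iff_re.1 h.symm).symm

theorem hasSum_oddSeries_ofReal {θ y : ℝ} {c : ℤ → ℝ} (hc : StripSummable θ c)
    (hy : y ∈ Ioo (-θ) θ) :
    HasSum (fun i : ℤ => c i * Real.exp ((2 * i + 1) * y)) (oddSeries c y).re := by
  refine (Complex.hasSum_re (hc.hasSum (ofReal_mem_strip hy))).of_eq (fun i => ?_) rfl
  rw [show (2 * i + 1 : ℂ) * y = ((2 * i + 1) * y : ℝ) by push_cast; ring, ← Complex.ofReal_exp,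
    ← Complex.ofReal_mul, Complex.ofReal_re]

theorem hasDerivAt_realSeries {θ y : ℝ} (hθ : 0 < θ) (hy : y ∈ Ioo (-θ) θ) :
    HasDerivAt (realSeries θ) (realSeriesDeriv θ y) y :=
  ((stripSummable_cschOdd hθ).hasDerivAt (ofReal_mem_strip hy)).real_of_complex

theorem realSeriesDeriv_pos {θ y : ℝ} (hθ : 0 < θ) (hy : y ∈ Ioo (-θ) θ) :
    0 < realSeriesDeriv θ y := by
  have h := hasSum_oddSeries_ofReal (stripSummable_cschOdd hθ).odd_mul hy
  have hpos : ∀ i : ℤ, 0 < (2 * i + 1) * cschOdd θ i * Real.exp ((2 * i + 1) * y) := fun i =>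
    mul_pos (odd_mul_cschOdd_pos hθ i) (Real.exp_pos _)
  rw [realSeriesDeriv, ← h.tsum_eq]
  exact h.summable.tsum_pos (fun i => (hpos i).le) 0 (hpos 0)

theorem realSeries_zero (θ : ℝ) : realSeries θ 0 = 0 := by
  have h := oddSeries_neg_of_odd (cschOdd_neg θ) 0
  rw [neg_zero] at h
  have h1 := congrArg Complex.re h
  rw [Complex.neg_re] at h1
  rw [realSeries, Complex.ofReal_zero]
  linarith

theorem tendsto_realSeries_atTop {θ : ℝ} (hθ : 0 < θ) :
    Tendsto (realSeries θ) (𝓝[<] θ) atTop := by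
  refine tendsto_atTop.2 fun B => ?_
  obtain ⟨L, hL⟩ := exists_nat_gt B
  -- a partial sum of the sine-hyperbolic series tends to `2 L`
  set F : ℝ → ℝ := fun y => ∑ l ∈ Finset.range L, 2 * cschOdd θ l * Real.sinh ((2 * l + 1) * y)
    with hF
  have hFc : Continuous F := by rw [hF]; fun_prop
  have hFθ : F θ = 2 * L := by
    have : ∀ l ∈ Finset.range L, 2 * cschOdd θ l * Real.sinh ((2 * l + 1) * θ) = 2 := by
      intro l _
      have := sinh_odd_ne_zero hθ l
      rw [cschOdd]
      push_cast at this ⊢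
      rw [mul_assoc, inv_mul_cancel₀ this, mul_one]
    rw [hF]
    dsimp only
    rw [Finset.sum_congr rfl this]
    simp [mul_comm]
  have h1 : ∀ᶠ y in 𝓝[<] θ, B < F y := by
    refine (hFc.continuousAt.tendsto.mono_left nhdsWithin_le_nhds).eventually_const_lt ?_
    rw [hFθ]
    have : (0 : ℝ) ≤ L := by positivity
    linarith
  filter_upwards [h1, Ioo_mem_nhdsLT hθ] with y hy hyθ
  refine hy.le.trans ?_
  have h2 := (hasSum_oddSeries_ofReal (stripSummable_cschOdd hθ)
    (show y ∈ Ioo (-θ) θ from ⟨by linarith [hyθ.1], hyθ.2⟩)).nat_add_neg_add_one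
  have h3 := h2.of_eq (g := fun l : ℕ => 2 * cschOdd θ l * Real.sinh ((2 * l + 1) * y))
    (fun l => by
      rw [show (-((l : ℤ) + 1)) = -1 - (l : ℤ) by ring, cschOdd_neg,
        show (2 * ((-1 - (l : ℤ) : ℤ) : ℝ) + 1) * y = -((2 * l + 1) * y) by push_cast; ring,
        Real.sinh_eq]
      push_cast; ring) rfl
  refine sum_le_hasSum _ (fun l _ => ?_) h3
  have := cschOdd_pos hθ l
  have : 0 ≤ Real.sinh ((2 * l + 1) * y) :=
    Real.sinh_nonneg_iff.2 (mul_nonneg (by positivity) hyθ.1.le)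
  positivity

/-! ### Identification with the Jacobi elliptic sine -/

/-- On the imaginary segment the substitution `t = R/√(M²+R²)` leads to the complementary elliptic
integral, whose complete value is therefore the time to blow-up. -/
theorem ellipticK_complementary {θ M lam : ℝ} (hθ : 0 < θ) (hM : 0 < M) (hMl : M < lam)
    (h : ∀ w ∈ strip θ, oddSeries (fun i => (2 * i + 1) * cschOdd θ i) w ^ 2 =
      (oddSeries (cschOdd θ) w ^ 2 + M ^ 2) * (oddSeries (cschOdd θ) w ^ 2 + lam ^ 2)) :
    ellipticK (√(1 - (M / lam) ^ 2)) = lam * θ := by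
  have hlam : 0 < lam := hM.trans hMl
  have hμ : M / lam ∈ Ioo (0 : ℝ) 1 := ⟨by positivity, (div_lt_one hlam).2 hMl⟩
  have hμ' := sqrt_one_sub_sq_mem hμ
  set R := realSeries θ with hR
  have hen : ∀ y ∈ Ioo (-θ) θ, realSeriesDeriv θ y ^ 2 = (R y ^ 2 + M ^ 2) * (R y ^ 2 + lam ^ 2) := by
    intro y hy
    have := h y (ofReal_mem_strip hy)
    rw [oddSeries_ofReal, oddSeries_ofReal (cschOdd θ)] at this
    exact Complex.ofReal_injective (by push_cast; exact this)
  set H : ℝ → ℝ := fun y => √(M ^ 2 + R y ^ 2) with hH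
  have hHpos : ∀ y, 0 < H y := fun y => Real.sqrt_pos.2 (by positivity)
  have hHsq : ∀ y, H y ^ 2 = M ^ 2 + R y ^ 2 := fun y => Real.sq_sqrt (by positivity)
  have hlt : ∀ y, |R y| < H y := fun y => by
    refine abs_lt_of_sq_lt_sq ?_ (hHpos y).le
    rw [hHsq]
    have : 0 < M ^ 2 := by positivity
    linarith
  have hmem : ∀ y, R y / H y ∈ Ioo (-1 : ℝ) 1 := fun y => by
    rw [mem_Ioo, ← abs_lt, abs_div, abs_of_pos (hHpos y), div_lt_one (hHpos y)]
    exact hlt y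
  have hHd : ∀ y ∈ Ioo (-θ) θ, HasDerivAt H (R y * realSeriesDeriv θ y / H y) y := by
    intro y hy
    have h1 := ((hasDerivAt_realSeries hθ hy).fun_pow 2).const_add (M ^ 2)
    refine (h1.sqrt (by positivity)).congr_deriv ?_
    rw [hH]
    dsimp only
    norm_num
    rw [mul_assoc, mul_div_mul_left _ _ two_ne_zero]
  have hz : (0 : ℝ) ∈ Ioo (-θ) θ := ⟨by linarith, hθ⟩
  refine ellipticK_eq_of_tendsto (a := -θ) (φ := fun y => R y / H y) hμ' (by linarith)
    (fun y _ => hmem y) (fun y hy => ?_) ?_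
  · refine ellipticW_comp_eq (φ := fun y => R y / H y)
      (φ' := fun y => realSeriesDeriv θ y * M ^ 2 / H y ^ 3) hμ' hlam hz
      (by simp [hR, realSeries_zero]) (fun y hy => ?_) (fun y _ => hmem y)
      (fun y hy => ?_) (fun y hy => ?_) hy
    · refine ((hasDerivAt_realSeries hθ hy).div (hHd y hy) (hHpos y).ne').congr_deriv ?_
      have h1 := hHsq y
      have h2 := (hHpos y).ne'
      have h3 : realSeries θ y = R y := rfl
      rw [h3, show M ^ 2 = H y ^ 2 - R y ^ 2 by linarith]
      generalize H y = a at *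
      field_simp
    · have := realSeriesDeriv_pos hθ hy
      have := hHpos y
      positivity
    · have h1 := hHsq y
      have h2 := (hHpos y).ne'
      rw [Real.sq_sqrt (by nlinarith [hμ.1, hμ.2]), div_pow, mul_pow, hen y hy,
        show R y ^ 2 = H y ^ 2 - M ^ 2 by linarith, div_pow,
        show R y ^ 2 = H y ^ 2 - M ^ 2 by linarith]
      generalize H y = a at *
      field_simp
      ring
  · -- squeeze: `R/(M+R) ≤ R/√(M²+R²) < 1`
    have hat := tendsto_realSeries_atTop hθ
    have h1 : Tendsto (fun y => 1 - M / (M + R y)) (𝓝[<] θ) (𝓝 (1 - 0)) :=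
      ((tendsto_const_nhds.add_atTop hat).const_div_atTop M).const_sub 1
    rw [sub_zero] at h1
    refine tendsto_of_tendsto_of_tendsto_of_le_of_le' h1 tendsto_const_nhds ?_
      (Eventually.of_forall fun y => (hmem y).2.le)
    filter_upwards [hat.eventually_gt_atTop 0] with y hy
    have hy' : 0 < R y := hy
    have h2 : H y ≤ M + R y := by
      refine (pow_le_pow_iff_left₀ (hHpos y).le (by positivity) two_ne_zero).1 ?_
      rw [hHsq]; nlinarith
    have h3 : 1 - M / (M + R y) = R y / (M + R y) := by
      have : M + R y ≠ 0 := by positivity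
      field_simp
      ring
    rw [h3]
    exact div_le_div_of_nonneg_left hy'.le (hHpos y) h2

theorem ellipticW_jacobiSeries {θ M lam : ℝ} (hθ : 0 < θ) (hM : 0 < M) (hMl : M < lam)
    (hMs : jacobiSeries θ (Real.pi / 2) = M)
    (h : ∀ x, jacobiSeriesDeriv θ x ^ 2 =
      (M ^ 2 - jacobiSeries θ x ^ 2) * (lam ^ 2 - jacobiSeries θ x ^ 2)) :
    ellipticK (M / lam) = lam * (Real.pi / 2) ∧
    ∀ x ∈ Icc (-(Real.pi / 2)) (Real.pi / 2), jacobiSeries θ x / M ∈ Icc (-1 : ℝ) 1 ∧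
      ellipticW (M / lam) (jacobiSeries θ x / M) = lam * x := by
  have hlam : 0 < lam := hM.trans hMl
  have hpi := Real.pi_pos
  have hμ : M / lam ∈ Ioo (0 : ℝ) 1 := ⟨by positivity, (div_lt_one hlam).2 hMl⟩
  have hmono := strictMonoOn_jacobiSeries hθ
  have hneg : jacobiSeries θ (-(Real.pi / 2)) = -M := by rw [jacobiSeries_neg, hMs]
  have hmem : ∀ x ∈ Ioo (-(Real.pi / 2)) (Real.pi / 2), jacobiSeries θ x / M ∈ Ioo (-1 : ℝ) 1 := by
    intro x hx
    have hx' := Ioo_subset_Icc_self hx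
    have h1 := hmono ⟨le_rfl, by linarith⟩ hx' hx.1
    have h2 := hmono hx' ⟨by linarith, le_rfl⟩ hx.2
    rw [hneg] at h1
    rw [hMs] at h2
    rw [mem_Ioo, lt_div_iff₀ hM, div_lt_iff₀ hM]
    constructor <;> linarith
  have hW : ∀ x ∈ Ioo (-(Real.pi / 2)) (Real.pi / 2),
      ellipticW (M / lam) (jacobiSeries θ x / M) = lam * x := by
    intro x hx
    refine ellipticW_comp_eq (φ := fun x => jacobiSeries θ x / M)
      (φ' := fun x => jacobiSeriesDeriv θ x / M) hμ hlam
      (by constructor <;> linarith) (by simp [jacobiSeries_zero])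
      (fun x _ => (hasDerivAt_jacobiSeries hθ x).div_const M) hmem
      (fun x hx => div_pos (jacobiSeriesDeriv_pos hθ hx) hM) (fun x _ => ?_) hx
    rw [div_pow, h, div_pow, div_pow]
    field_simp
  have hc : Continuous fun x => jacobiSeries θ x / M := (continuous_jacobiSeries hθ).div_const M
  have hK : ellipticK (M / lam) = lam * (Real.pi / 2) := by
    refine ellipticK_eq_of_tendsto hμ (by linarith) hmem hW ?_
    have := hc.tendsto (Real.pi / 2)
    rw [hMs, div_self hM.ne'] at this
    exact this.mono_left nhdsWithin_le_nhds
  refine ⟨hK, ?_⟩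
  have hmaps : MapsTo (fun x => jacobiSeries θ x / M) (Icc (-(Real.pi / 2)) (Real.pi / 2))
      (Icc (-1) 1) := by
    intro x hx
    have h1 := hmono.monotoneOn ⟨le_rfl, by linarith⟩ hx hx.1
    have h2 := hmono.monotoneOn hx ⟨by linarith, le_rfl⟩ hx.2
    rw [hneg] at h1
    rw [hMs] at h2
    simp only [mem_Icc]
    rw [le_div_iff₀ hM, div_le_iff₀ hM]
    constructor <;> linarith
  have hEq : EqOn (ellipticW (M / lam) ∘ fun x => jacobiSeries θ x / M) (fun x => lam * x)
      (Icc (-(Real.pi / 2)) (Real.pi / 2)) := by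
    refine EqOn.of_subset_closure (s := Ioo (-(Real.pi / 2)) (Real.pi / 2)) hW
      ((continuousOn_ellipticW hμ).comp hc.continuousOn hmaps) (by fun_prop) Ioo_subset_Icc_self ?_
    rw [closure_Ioo (by linarith)]
  exact fun x hx => ⟨hmaps hx, hEq hx⟩

/-- The Jacobi sine as an amplitude-normalized `jacobiSeries`. -/
theorem jacobiSn_eq {θ M lam : ℝ} (hM : 0 < M) (hMl : M < lam)
    (hK : ellipticK (M / lam) = lam * (Real.pi / 2))
    (hW : ∀ x ∈ Icc (-(Real.pi / 2)) (Real.pi / 2), jacobiSeries θ x / M ∈ Icc (-1 : ℝ) 1 ∧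
      ellipticW (M / lam) (jacobiSeries θ x / M) = lam * x) (x : ℝ) :
    jacobiSn (lam * x) (M / lam) = jacobiSeries θ x / M := by
  have hlam : 0 < lam := hM.trans hMl
  have hpi := Real.pi_pos
  have hμ : M / lam ∈ Ioo (0 : ℝ) 1 := ⟨by positivity, (div_lt_one hlam).2 hMl⟩
  have hinv : ∀ y ∈ Icc (-(Real.pi / 2)) (Real.pi / 2),
      ellipticWInv (M / lam) (lam * y) = jacobiSeries θ y / M := by
    intro y hy
    rw [ellipticWInv, ← (hW y hy).2]
    exact (strictMonoOn_ellipticW hμ).injOn.leftInvOn_invFunOn (hW y hy).1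
  set k := ⌊(lam * x + lam * (Real.pi / 2)) / (4 * (lam * (Real.pi / 2)))⌋ with hk
  have hf0 := Int.fract_nonneg ((lam * x + lam * (Real.pi / 2)) / (4 * (lam * (Real.pi / 2))))
  have hf1 := Int.fract_lt_one ((lam * x + lam * (Real.pi / 2)) / (4 * (lam * (Real.pi / 2))))
  have hr : 4 * (lam * (Real.pi / 2)) *
      Int.fract ((lam * x + lam * (Real.pi / 2)) / (4 * (lam * (Real.pi / 2)))) -
      lam * (Real.pi / 2) = lam * (x - k * (2 * Real.pi)) := by
    rw [Int.fract, ← hk]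
    field_simp
    ring
  set y := x - k * (2 * Real.pi) with hy
  have hy1 : -(Real.pi / 2) ≤ y := by
    have : 0 ≤ 4 * (lam * (Real.pi / 2)) *
      Int.fract ((lam * x + lam * (Real.pi / 2)) / (4 * (lam * (Real.pi / 2)))) := by positivity
    have : 0 ≤ lam * (y + Real.pi / 2) := by linarith
    have := nonneg_of_mul_nonneg_right this hlam
    linarith
  have hy2 : y < 3 * (Real.pi / 2) := by
    have : 4 * (lam * (Real.pi / 2)) *
      Int.fract ((lam * x + lam * (Real.pi / 2)) / (4 * (lam * (Real.pi / 2)))) <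
      4 * (lam * (Real.pi / 2)) := mul_lt_of_lt_one_right (by positivity) hf1
    have : lam * y < lam * (3 * (Real.pi / 2)) := by linarith
    exact lt_of_mul_lt_mul_left this hlam.le
  have hxy : jacobiSeries θ x = jacobiSeries θ y := by
    rw [← jacobiSeries_add_int_mul_two_pi θ y k, hy, sub_add_cancel]
  rw [jacobiSn]
  simp only [hK, hr]
  rw [hxy]
  split_ifs with h
  · exact hinv y ⟨hy1, le_of_mul_le_mul_left h hlam⟩
  · have h1 : Real.pi / 2 < y := by
      by_contra! h2
      exact h (mul_le_mul_of_nonneg_left h2 hlam.le)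
    rw [show 2 * (lam * (Real.pi / 2)) - lam * y = lam * (Real.pi - y) by ring,
      hinv _ (by constructor <;> linarith), jacobiSeries_pi_sub]

/-- Every modulus of nome `exp(-2θ)` comes from `jacobiSeries θ`. -/
theorem exists_jacobiSn_eq {μ θ : ℝ} (hμ : μ ∈ Ioo (0 : ℝ) 1) (hθ : nome μ = Real.exp (-(2 * θ))) :
    ∃ M lam : ℝ, 0 < M ∧ 0 < lam ∧ μ = M / lam ∧ ellipticK μ = lam * (Real.pi / 2) ∧
      jacobiSeries θ (Real.pi / 2) = M ∧
      (∀ x, HasDerivAt (jacobiSeriesDeriv θ)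
        (jacobiSeries θ x * (2 * jacobiSeries θ x ^ 2 - M ^ 2 - lam ^ 2)) x) ∧
      ∀ x, jacobiSn (lam * x) μ = jacobiSeries θ x / M := by
  have hθ0 : 0 < θ := by
    have h := (nome_mem hμ).2
    rw [hθ, Real.exp_lt_one_iff] at h
    linarith
  obtain ⟨M, lam, hM, hMl, hMs, hode, hfac, hstrip⟩ := exists_jacobiSeries_factor hθ0
  have hlam : 0 < lam := hM.trans hMl
  obtain ⟨hK, hW⟩ := ellipticW_jacobiSeries hθ0 hM hMl hMs hfac
  have hμ' : M / lam ∈ Ioo (0 : ℝ) 1 := ⟨by positivity, (div_lt_one hlam).2 hMl⟩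
  have hn : nome (M / lam) = Real.exp (-(2 * θ)) := by
    rw [nome, hK, ellipticK_complementary hθ0 hM hMl hstrip]
    congr 2
    have := Real.pi_pos
    field_simp
  have hμeq : μ = M / lam := strictMonoOn_nome.injOn hμ hμ' (hθ.trans hn.symm)
  subst hμeq
  exact ⟨M, lam, hM, hlam, rfl, hK, hMs, hode, jacobiSn_eq hM hMl hK hW⟩

/-! ### The eigenfunctions -/

/-- The weight `q^l (1-q) / (1-q^{2l+1})` of the `(2l+1)`-st harmonic relative to the first one in
the Fourier series of the Jacobi sine of nome `q`. -/
def harmonicRatio (q : ℝ) (l : ℕ) : ℝ := (1 - q) * q ^ l / (1 - q ^ (2 * l + 1))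

theorem one_sub_pow_pos {q : ℝ} (h0 : 0 ≤ q) (h1 : q < 1) (l : ℕ) : 0 < 1 - q ^ (2 * l + 1) :=
  sub_pos.2 (pow_lt_one₀ h0 h1 (by omega))

theorem cschOdd_eq {q θ : ℝ} (hθ : 0 < θ) (hq : q = Real.exp (-(2 * θ))) (l : ℕ) :
    cschOdd θ l = 2 * Real.exp (-θ) / (1 - q) * harmonicRatio q l := by
  have hq1 : q < 1 := by rw [hq, Real.exp_lt_one_iff]; linarith
  have hq0 : 0 < q := by rw [hq]; exact Real.exp_pos _
  have h1 := (one_sub_pow_pos hq0.le hq1 l).ne'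
  have h2 : 1 - q ≠ 0 := by linarith
  have h3 : q = Real.exp (-θ) ^ 2 := by
    rw [hq, ← Real.exp_nat_mul]; congr 1; push_cast; ring
  have h4 : Real.sinh ((2 * (l : ℤ) + 1) * θ) =
      (1 - q ^ (2 * l + 1)) / (2 * (Real.exp (-θ) * q ^ l)) := by
    have e1 : Real.exp (-((2 * (l : ℤ) + 1) * θ)) = Real.exp (-θ) * q ^ l := by
      rw [h3, ← pow_mul, ← pow_succ', ← Real.exp_nat_mul]
      congr 1; push_cast; ring
    have e2 : Real.exp ((2 * (l : ℤ) + 1) * θ) = (Real.exp (-θ) * q ^ l)⁻¹ := by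
      rw [← e1, ← Real.exp_neg, neg_neg]
    rw [Real.sinh_eq, e1, e2]
    have e3 : q ^ (2 * l + 1) = (Real.exp (-θ) * q ^ l) ^ 2 := by
      rw [mul_pow, ← h3]; ring
    rw [e3]
    have : Real.exp (-θ) * q ^ l ≠ 0 := by positivity
    generalize Real.exp (-θ) * q ^ l = a at *
    field_simp
  rw [cschOdd]
  push_cast at h4 ⊢
  rw [h4, harmonicRatio]
  field_simp

theorem exists_eigenfunction_eq {μ : ℝ} (hμ : μ ∈ Ioo (0 : ℝ) 1) :
    ∃ θ : ℝ, 0 < θ ∧ nome μ = Real.exp (-(2 * θ)) ∧ ∀ n : ℕ+, ∃ C : ℝ, C ≠ 0 ∧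
      (∀ x, eigenfunction n μ x = C * jacobiSeries θ (n * Real.pi * x)) ∧
      IsEigenfunction (eigenvalue n μ) (eigenfunction n μ) := by
  have hnm := nome_mem hμ
  have hθ : nome μ = Real.exp (-(2 * (-Real.log (nome μ) / 2))) := by
    rw [show -(2 * (-Real.log (nome μ) / 2)) = Real.log (nome μ) by ring, Real.exp_log hnm.1]
  have hθ0 : 0 < -Real.log (nome μ) / 2 := by
    have := Real.log_neg hnm.1 hnm.2
    linarith
  set θ := -Real.log (nome μ) / 2
  obtain ⟨M, lam, hM, hlam, hμeq, hK, hMs, hode, hsn⟩ := exists_jacobiSn_eq hμ hθ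
  have hpi := Real.pi_pos
  refine ⟨θ, hθ0, hθ, fun n => ?_⟩
  have hn : (0 : ℝ) < n := by exact_mod_cast n.pos
  set A : ℝ := (2 : ℝ) ^ (3 / 2 : ℝ) * n * μ * ellipticK μ with hA
  have hA0 : 0 < A := by
    have := ellipticK_pos hμ
    have := hμ.1
    positivity
  have hAsq : A ^ 2 = 2 * (n * Real.pi * M) ^ 2 := by
    have h2 : ((2 : ℝ) ^ (3 / 2 : ℝ)) ^ 2 = 8 := by
      rw [← Real.rpow_natCast, ← Real.rpow_mul (by norm_num)]
      norm_num
    rw [hA, mul_pow, mul_pow, mul_pow, h2, hK, hμeq]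
    field_simp
    ring
  have heq : ∀ x, eigenfunction n μ x = A / M * jacobiSeries θ (n * Real.pi * x) := by
    intro x
    rw [eigenfunction, ← hA, show 2 * ellipticK μ * n * x = lam * (n * Real.pi * x) by
      rw [hK]; ring, hsn]
    ring
  have hlin : ∀ x : ℝ, HasDerivAt (fun x : ℝ => n * Real.pi * x) (n * Real.pi) x := fun x => by
    simpa using (hasDerivAt_id x).const_mul ((n : ℝ) * Real.pi)
  have hd1 : ∀ x, HasDerivAt (eigenfunction n μ)
      (A / M * (jacobiSeriesDeriv θ (n * Real.pi * x) * (n * Real.pi))) x := by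
    intro x
    rw [funext heq]
    exact ((hasDerivAt_jacobiSeries hθ0 _).comp x (hlin x)).const_mul _
  have hderiv : deriv (eigenfunction n μ) =
      fun x => A / M * (jacobiSeriesDeriv θ (n * Real.pi * x) * (n * Real.pi)) :=
    funext fun x => (hd1 x).deriv
  have hd2 : ∀ x, HasDerivAt (deriv (eigenfunction n μ))
      (A / M * (jacobiSeries θ (n * Real.pi * x) *
        (2 * jacobiSeries θ (n * Real.pi * x) ^ 2 - M ^ 2 - lam ^ 2) * (n * Real.pi) *
          (n * Real.pi))) x := by
    intro x
    rw [hderiv]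
    exact (((hode _).comp x (hlin x)).mul_const _).const_mul _
  have hcont := continuous_jacobiSeries hθ0
  refine ⟨A / M, by positivity, heq, ?_, fun x _ => ?_, ?_, ?_, ?_⟩
  · refine ContDiff.contDiffOn ?_
    rw [show (2 : WithTop ℕ∞) = 1 + 1 by norm_num, contDiff_succ_iff_deriv]
    refine ⟨fun x => (hd1 x).differentiableAt, by simp, ?_⟩
    rw [contDiff_one_iff_deriv]
    refine ⟨fun x => (hd2 x).differentiableAt, ?_⟩
    rw [funext fun x => (hd2 x).deriv]
    fun_prop
  · rw [(hd2 x).deriv, heq, eigenvalue, hK, hμeq]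
    have h3 : (A / M * jacobiSeries θ (n * Real.pi * x)) ^ 3 =
        A / M * (2 * (n * Real.pi) ^ 2) * jacobiSeries θ (n * Real.pi * x) ^ 3 := by
      rw [mul_pow, pow_succ (A / M) 2, div_pow, hAsq]
      field_simp
    rw [h3]
    generalize jacobiSeries θ (n * Real.pi * x) = s
    field_simp
    ring
  · rw [heq, mul_zero, jacobiSeries_zero, mul_zero]
  · have h := hasSum_jacobiSeries hθ0 (n * Real.pi * 1)
    have h0 := h.unique (hasSum_zero.of_eq (fun l => by
      rw [show (2 * (l : ℝ) + 1) * (n * Real.pi * 1) = (((2 * l + 1) * n : ℕ) : ℝ) * Real.pi by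
        push_cast; ring, Real.sin_nat_mul_pi, mul_zero]) rfl)
    rw [heq, h0, mul_zero]
  · have hn1 : (1 : ℝ) ≤ n := by exact_mod_cast (one_le : 1 ≤ n)
    refine ⟨1 / (2 * n), ⟨by positivity, ?_⟩, ?_⟩
    · rw [div_le_one (by positivity)]; linarith
    · rw [heq, show (n : ℝ) * Real.pi * (1 / (2 * n)) = Real.pi / 2 by field_simp, hMs]
      positivity

/-! ### The threshold function -/

theorem harmonicRatio_nonneg {q : ℝ} (h0 : 0 ≤ q) (h1 : q < 1) (l : ℕ) : 0 ≤ harmonicRatio q l :=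
  div_nonneg (mul_nonneg (by linarith) (by positivity)) (one_sub_pow_pos h0 h1 l).le

theorem harmonicRatio_pos {q : ℝ} (h0 : 0 < q) (h1 : q < 1) (l : ℕ) : 0 < harmonicRatio q l :=
  div_pos (mul_pos (by linarith) (by positivity)) (one_sub_pow_pos h0.le h1 l)

theorem harmonicRatio_zero_right {q : ℝ} (h1 : q < 1) : harmonicRatio q 0 = 1 := by
  have : 1 - q ≠ 0 := by linarith
  simp [harmonicRatio, this]

theorem harmonicRatio_le_pow {q : ℝ} (h0 : 0 ≤ q) (h1 : q < 1) (l : ℕ) :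
    harmonicRatio q l ≤ q ^ l := by
  rw [harmonicRatio, div_le_iff₀ (one_sub_pow_pos h0 h1 l), mul_comm]
  refine mul_le_mul_of_nonneg_left ?_ (by positivity)
  have := pow_le_of_le_one h0 h1.le (show 2 * l + 1 ≠ 0 by omega)
  linarith

theorem inv_harmonicRatio_succ {q : ℝ} (h0 : 0 < q) (h1 : q < 1) (l : ℕ) :
    (harmonicRatio q (l + 1))⁻¹ = (harmonicRatio q l)⁻¹ + (q ^ (l + 1) + (q ^ (l + 1))⁻¹) := by
  have : 1 - q ≠ 0 := by linarith
  rw [harmonicRatio, harmonicRatio, inv_div, inv_div]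
  field_simp
  ring

theorem inv_harmonicRatio_le {p q : ℝ} (h0 : 0 < p) (hpq : p < q) (h1 : q < 1) (l : ℕ) :
    (harmonicRatio q l)⁻¹ ≤ (harmonicRatio p l)⁻¹ ∧
      (harmonicRatio q (l + 1))⁻¹ < (harmonicRatio p (l + 1))⁻¹ := by
  have hstep : ∀ l : ℕ, q ^ (l + 1) + (q ^ (l + 1))⁻¹ < p ^ (l + 1) + (p ^ (l + 1))⁻¹ := by
    intro l
    have e1 : p ^ (l + 1) < q ^ (l + 1) := pow_lt_pow_left₀ hpq h0.le (by omega)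
    have e2 : q ^ (l + 1) < 1 := pow_lt_one₀ (h0.trans hpq).le h1 (by omega)
    have e3 : 0 < p ^ (l + 1) := by positivity
    generalize p ^ (l + 1) = a at *
    generalize q ^ (l + 1) = b at *
    have hb : 0 < b := e3.trans e1
    have : a + a⁻¹ - (b + b⁻¹) = (b - a) * (1 - a * b) / (a * b) := by field_simp; ring
    have : 0 < (b - a) * (1 - a * b) / (a * b) :=
      div_pos (mul_pos (by linarith) (by nlinarith)) (by positivity)
    linarith
  induction l with
  | zero =>
    rw [harmonicRatio_zero_right h1, harmonicRatio_zero_right (hpq.trans h1),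
      inv_harmonicRatio_succ (h0.trans hpq) h1, inv_harmonicRatio_succ h0 (hpq.trans h1),
      harmonicRatio_zero_right h1, harmonicRatio_zero_right (hpq.trans h1)]
    exact ⟨le_rfl, by linarith [hstep 0]⟩
  | succ k ih =>
    refine ⟨ih.2.le, ?_⟩
    rw [inv_harmonicRatio_succ (h0.trans hpq) h1, inv_harmonicRatio_succ h0 (hpq.trans h1)]
    linarith [hstep (k + 1), ih.2]

theorem harmonicRatio_mono {p q : ℝ} (h0 : 0 < p) (hpq : p ≤ q) (h1 : q < 1) (l : ℕ) :
    harmonicRatio p l ≤ harmonicRatio q l := by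
  rcases hpq.eq_or_lt with rfl | h
  · exact le_rfl
  · exact (inv_le_inv₀ (harmonicRatio_pos (h0.trans h) h1 l)
      (harmonicRatio_pos h0 (h.trans h1) l)).1 (inv_harmonicRatio_le h0 h h1 l).1

theorem harmonicRatio_one_lt {p q : ℝ} (h0 : 0 < p) (hpq : p < q) (h1 : q < 1) :
    harmonicRatio p 1 < harmonicRatio q 1 :=
  (inv_lt_inv₀ (harmonicRatio_pos (h0.trans hpq) h1 1)
    (harmonicRatio_pos h0 (hpq.trans h1) 1)).1 (inv_harmonicRatio_le h0 hpq h1 0).2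

theorem pow_div_le_harmonicRatio {q : ℝ} (h0 : 0 ≤ q) (h1 : q < 1) (l : ℕ) :
    q ^ l / (2 * l + 1) ≤ harmonicRatio q l := by
  have h2 : 1 - q ^ (2 * l + 1) ≤ (1 - q) * (2 * l + 1) := by
    have h3 := geom_sum_mul_neg q (2 * l + 1)
    have h4 : ∑ i ∈ Finset.range (2 * l + 1), q ^ i ≤ 2 * l + 1 := by
      refine (Finset.sum_le_card_nsmul _ _ 1 fun i _ => pow_le_one₀ h0 h1.le).trans_eq ?_
      simp
    rw [← h3, mul_comm]
    exact mul_le_mul_of_nonneg_left h4 (by linarith)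
  rw [harmonicRatio, div_le_div_iff₀ (by positivity) (one_sub_pow_pos h0 h1 l)]
  have := mul_le_mul_of_nonneg_left h2 (show 0 ≤ q ^ l by positivity)
  linarith

theorem summable_rpow_mul_pow {α q : ℝ} (h0 : 0 ≤ q) (h1 : q < 1) :
    Summable fun l : ℕ => (2 * (l : ℝ) + 1) ^ α * q ^ l := by
  obtain ⟨k, hk⟩ := exists_nat_ge α
  have h := summable_norm_mul_geometric_of_norm_lt_one (k := k) (r := q)
    (u := fun l : ℕ => (2 * l + 1) ^ k) (by rwa [Real.norm_of_nonneg h0]) (by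
      refine Asymptotics.IsBigO.of_bound (3 ^ k) ?_
      filter_upwards [eventually_ge_atTop 1] with l hl
      rw [Real.norm_of_nonneg (by positivity), Real.norm_of_nonneg (by positivity)]
      have : (2 * l + 1) ^ k ≤ 3 ^ k * l ^ k := by
        rw [← mul_pow]; exact Nat.pow_le_pow_left (by omega) k
      exact_mod_cast this)
  refine Summable.of_nonneg_of_le (fun l => by positivity) (fun l => ?_) h
  rw [Real.norm_of_nonneg (by positivity)]
  refine mul_le_mul_of_nonneg_right ?_ (by positivity)
  push_cast
  rw [← Real.rpow_natCast]
  exact Real.rpow_le_rpow_of_exponent_le (by linarith [(Nat.cast_nonneg l : (0 : ℝ) ≤ l)]) hk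

theorem summable_sFun {α q : ℝ} (h0 : 0 ≤ q) (h1 : q < 1) :
    Summable fun l : ℕ => (2 * (l : ℝ) + 1) ^ α * harmonicRatio q l :=
  Summable.of_nonneg_of_le
    (fun l => mul_nonneg (by positivity) (harmonicRatio_nonneg h0 h1 l))
    (fun l => mul_le_mul_of_nonneg_left (harmonicRatio_le_pow h0 h1 l) (by positivity))
    (summable_rpow_mul_pow h0 h1)

theorem hasSum_sFun {α q : ℝ} (h0 : 0 ≤ q) (h1 : q < 1) :
    HasSum (fun l : ℕ => (2 * (l : ℝ) + 1) ^ α * harmonicRatio q l) (sFun α q) :=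
  (summable_sFun h0 h1).hasSum

theorem strictMonoOn_sFun (α : ℝ) : StrictMonoOn (sFun α) (Ioo 0 1) := by
  intro p hp q hq hpq
  refine hasSum_lt (i := 1) (fun l => ?_) ?_ (hasSum_sFun hp.1.le hp.2)
    (hasSum_sFun hq.1.le hq.2)
  · exact mul_le_mul_of_nonneg_left (harmonicRatio_mono hp.1 hpq.le hq.2 l) (by positivity)
  · exact mul_lt_mul_of_pos_left (harmonicRatio_one_lt hp.1 hpq hq.2) (by positivity)

theorem continuousOn_sFun {α b : ℝ} (h0 : 0 ≤ b) (h1 : b < 1) :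
    ContinuousOn (sFun α) (Icc 0 b) := by
  refine continuousOn_tsum (u := fun l : ℕ => (2 * (l : ℝ) + 1) ^ α * b ^ l) (fun l => ?_)
    (summable_rpow_mul_pow h0 h1) fun l q hq => ?_
  · refine ContinuousOn.mul continuousOn_const (ContinuousOn.div (by fun_prop) (by fun_prop) ?_)
    exact fun q hq => (one_sub_pow_pos hq.1 (hq.2.trans_lt h1) l).ne'
  · have h := harmonicRatio_nonneg hq.1 (hq.2.trans_lt h1) l
    change ‖(2 * (l : ℝ) + 1) ^ α * harmonicRatio q l‖ ≤ _
    rw [Real.norm_of_nonneg (mul_nonneg (by positivity) h)]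
    refine mul_le_mul_of_nonneg_left ?_ (by positivity)
    exact (harmonicRatio_le_pow hq.1 (hq.2.trans_lt h1) l).trans (pow_le_pow_left₀ hq.1 hq.2 l)

theorem sFun_zero_right (α : ℝ) : sFun α 0 = 1 := by
  rw [sFun, tsum_eq_single 0]
  · simp
  · intro l hl
    simp [hl]

theorem exists_two_lt_sFun {α : ℝ} (hα : 0 ≤ α) : ∃ b ∈ Ioo (0 : ℝ) 1, 2 < sFun α b := by
  -- the series dominates the divergent series `∑ q^l / (2l+1)`
  have hdiv : ¬ Summable fun l : ℕ => (1 : ℝ) / (2 * l + 1) := by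
    intro h
    refine Real.not_summable_one_div_natCast ?_
    rw [← summable_nat_add_iff 1]
    refine Summable.of_nonneg_of_le (fun _ => by positivity) (fun l => ?_) (h.mul_left 2)
    rw [← mul_div_assoc, mul_one, div_le_div_iff₀ (by positivity) (by positivity)]
    push_cast; linarith
  have ht := (not_summable_iff_tendsto_nat_atTop_of_nonneg (fun l => by positivity)).1 hdiv
  obtain ⟨L, hL⟩ := (ht.eventually_gt_atTop 2).exists
  have hc : Continuous fun q : ℝ => ∑ l ∈ Finset.range L, q ^ l / (2 * (l : ℝ) + 1) := by fun_prop
  have h1 : ∀ᶠ q in 𝓝[<] (1 : ℝ), 2 < ∑ l ∈ Finset.range L, q ^ l / (2 * (l : ℝ) + 1) :=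
    (hc.continuousAt.tendsto.mono_left nhdsWithin_le_nhds).eventually_const_lt
      (by simpa using hL)
  obtain ⟨b, hb, hb'⟩ := (h1.and (Ioo_mem_nhdsLT one_pos)).exists
  refine ⟨b, hb', hb.trans_le ?_⟩
  refine (Finset.sum_le_sum fun l _ => ?_).trans
    (sum_le_hasSum (Finset.range L) (fun l _ => ?_) (hasSum_sFun hb'.1.le hb'.2))
  · refine (pow_div_le_harmonicRatio hb'.1.le hb'.2 l).trans ?_
    exact le_mul_of_one_le_left (harmonicRatio_nonneg hb'.1.le hb'.2 l)
      (Real.one_le_rpow (by linarith [(Nat.cast_nonneg l : (0 : ℝ) ≤ l)]) hα)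
  · exact mul_nonneg (by positivity) (harmonicRatio_nonneg hb'.1.le hb'.2 l)

theorem existsUnique_sFun_eq_two {α : ℝ} (hα : 0 ≤ α) :
    ∃! r : ℝ, r ∈ Ioo 0 1 ∧ sFun α r = 2 := by
  obtain ⟨b, hb, h2⟩ := exists_two_lt_sFun hα
  obtain ⟨r, hr, hr2⟩ := intermediate_value_Icc hb.1.le (continuousOn_sFun hb.1.le hb.2)
    (show (2 : ℝ) ∈ Icc (sFun α 0) (sFun α b) from ⟨by rw [sFun_zero_right]; norm_num, h2.le⟩)
  have hr0 : r ≠ 0 := by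
    rintro rfl
    rw [sFun_zero_right] at hr2
    norm_num at hr2
  have hr' : r ∈ Ioo (0 : ℝ) 1 := ⟨lt_of_le_of_ne hr.1 hr0.symm, hr.2.trans_lt hb.2⟩
  exact ⟨r, ⟨hr', hr2⟩, fun s hs =>
    (strictMonoOn_sFun α).injOn hs.1 hr' (hs.2.trans hr2.symm)⟩

/-! ### The sine basis of `L²(0,1)` -/

theorem memLp_ofReal_of_continuous {g : ℝ → ℝ} (hg : Continuous g) :
    MemLp (fun x => (g x : ℂ)) 2 (volume.restrict (Ioo (0 : ℝ) 1)) := by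
  obtain ⟨C, hC⟩ := isCompact_Icc.exists_bound_of_continuousOn (s := Icc (0 : ℝ) 1) hg.continuousOn
  refine MemLp.of_bound (Continuous.aestronglyMeasurable (by fun_prop)) C ?_
  filter_upwards [ae_restrict_mem measurableSet_Ioo] with x hx
  rw [Complex.norm_real]
  exact hC x (Ioo_subset_Icc_self hx)

theorem sineCoeff_toLp {g : ℝ → ℝ} (hg : Continuous g) (k : ℕ+) :
    sineCoeff ((memLp_ofReal_of_continuous hg).toLp _) k =
      ((√2 * ∫ x in (0 : ℝ)..1, g x * Real.sin (k * Real.pi * x) : ℝ) : ℂ) := by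
  rw [sineCoeff, intervalIntegral.integral_of_le zero_le_one, integral_Ioc_eq_integral_Ioo,
    Complex.ofReal_mul, ← integral_complex_ofReal]
  congr 1
  refine integral_congr_ae ?_
  filter_upwards [(memLp_ofReal_of_continuous hg).coeFn_toLp] with x hx
  rw [hx]
  push_cast; rfl

/-- The orthonormal sine functions `√2 sin(nπx)`. -/
def sineL2 (n : ℕ+) : L2I :=
  (memLp_ofReal_of_continuous
    (show Continuous fun x : ℝ => √2 * Real.sin (n * Real.pi * x) by fun_prop)).toLp _

theorem inner_sineL2 (n : ℕ+) (f : L2I) : inner ℂ (sineL2 n) f = sineCoeff f n := by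
  rw [L2.inner_def, sineCoeff, ← integral_const_mul]
  refine integral_congr_ae ?_
  filter_upwards [(memLp_ofReal_of_continuous (show Continuous fun x : ℝ =>
    √2 * Real.sin (n * Real.pi * x) by fun_prop)).coeFn_toLp] with x hx
  rw [sineL2, hx, RCLike.inner_apply, Complex.conj_ofReal]
  push_cast; ring

theorem orthonormal_sineL2 : Orthonormal ℂ sineL2 := by
  rw [orthonormal_iff_ite]
  intro m k
  rw [inner_sineL2, sineL2, sineCoeff_toLp (by fun_prop)]
  simp only [mul_assoc, intervalIntegral.integral_const_mul]
  have := integral_sin_mul_sin k m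
  simp only [mul_assoc] at this
  rw [this, ← mul_assoc, Real.mul_self_sqrt (by norm_num)]
  by_cases h : m = k
  · simp [h]
  · rw [if_neg h, if_neg (Ne.symm h)]; simp

/-- The Hilbert basis `√2 sin(nπx)` of `L²(0,1)`. -/
def sineBasis : HilbertBasis ℕ+ ℂ L2I :=
  HilbertBasis.mkOfOrthogonalEqBot orthonormal_sineL2 (by
    rw [Submodule.eq_bot_iff]
    intro f hf
    refine eq_zero_of_sineCoeff_eq_zero f fun n => ?_
    rw [← inner_sineL2]
    exact Submodule.inner_right_of_mem_orthogonal (Submodule.subset_span (mem_range_self n)) hf)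

theorem sineCoeff_sineBasis_repr_symm (v : lp (fun _ : ℕ+ => ℂ) 2) (n : ℕ+) :
    sineCoeff (sineBasis.repr.symm v) n = v n := by
  have h : sineBasis n = sineL2 n := by
    rw [sineBasis, HilbertBasis.coe_mkOfOrthogonalEqBot]
  rw [← inner_sineL2, ← h, ← HilbertBasis.repr_apply_apply, LinearIsometryEquiv.apply_symm_apply]

theorem SobolevH.toEll2_apply {α : ℝ} (f : SobolevH α) (n : ℕ+) :
    SobolevH.toEll2 α f n = (((n : ℝ) ^ α : ℝ) : ℂ) * sineCoeff f.toL2 n := rfl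

theorem SobolevH.toEll2_surjective {α : ℝ} (hα : 0 ≤ α) :
    Function.Surjective (SobolevH.toEll2 α) := by
  intro v
  have hpos : ∀ n : ℕ+, (1 : ℝ) ≤ (n : ℝ) ^ α := fun n =>
    Real.one_le_rpow (by exact_mod_cast (one_le : 1 ≤ n)) hα
  have hw : Memℓp (fun n : ℕ+ => (((n : ℝ) ^ α : ℝ) : ℂ)⁻¹ * v n) 2 := by
    have hv := lp.memℓp v
    rw [memℓp_gen_iff (by norm_num)] at hv ⊢
    refine Summable.of_nonneg_of_le (fun _ => by positivity) (fun n => ?_) hv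
    refine Real.rpow_le_rpow (norm_nonneg _) ?_ (by norm_num)
    rw [norm_mul, norm_inv, Complex.norm_real, Real.norm_of_nonneg (by linarith [hpos n])]
    exact mul_le_of_le_one_left (norm_nonneg _) (inv_le_one_of_one_le₀ (hpos n))
  set f : L2I := sineBasis.repr.symm ⟨_, hw⟩ with hf
  have hc : ∀ n : ℕ+, (((n : ℝ) ^ α : ℝ) : ℂ) * sineCoeff f n = v n := by
    intro n
    rw [hf, sineCoeff_sineBasis_repr_symm]
    change _ * (_ * v n) = v n
    rw [mul_inv_cancel_left₀]
    exact Complex.ofReal_ne_zero.2 (by linarith [hpos n])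
  have hmem : f ∈ sobolevSubmodule α := by
    refine (memlp_iff_summable α f).1 ?_
    rw [funext hc]
    exact lp.memℓp v
  refine ⟨(⟨f, hmem⟩ : sobolevSubmodule α), ?_⟩
  ext n
  exact hc n

/-- The isometric isomorphism `f ↦ (n^α f̂(n))ₙ` of `H^α` onto `ℓ²`. -/
def SobolevH.equivEll2 {α : ℝ} (hα : 0 ≤ α) :
    SobolevH α ≃ₗᵢ[ℂ] lp (fun _ : ℕ+ => ℂ) 2 where
  toLinearEquiv := LinearEquiv.ofBijective (SobolevH.toEll2 α)
    ⟨SobolevH.toEll2_injective α, SobolevH.toEll2_surjective hα⟩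
  norm_map' _ := rfl

/-! ### Perturbation of the standard basis of `ℓ²` -/

theorem exists_weighted_shift {φ : ℕ+ → ℕ+} (hφ : Function.Injective φ) {d : ℕ+ → ℝ} {c : ℝ}
    (hd : ∀ n, |d n| ≤ c) : ∃ B : lp (fun _ : ℕ+ => ℂ) 2 →L[ℂ] lp (fun _ : ℕ+ => ℂ) 2,
      ‖B‖ ≤ c ∧ ∀ n, B (lp.single 2 n 1) = (d n : ℂ) • lp.single 2 (φ n) 1 := by
  have hc : 0 ≤ c := (abs_nonneg _).trans (hd 1)
  set E : (ℕ+ → ℂ) → ℕ+ → ℂ := fun v => Function.extend φ (fun n => (d n : ℂ) * v n) 0 with hE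
  have hEφ : ∀ v n, E v (φ n) = d n * v n := fun v n => hφ.extend_apply _ _ _
  have hE0 : ∀ v k, (¬∃ n, φ n = k) → E v k = 0 := fun v k hk =>
    Function.extend_apply' _ _ _ hk
  have hsum : ∀ v : lp (fun _ : ℕ+ => ℂ) 2,
      HasSum (fun n => ‖(d n : ℂ) * v n‖ ^ (2 : ℝ)) (∑' n, ‖(d n : ℂ) * v n‖ ^ (2 : ℝ)) ∧
        ∑' n, ‖(d n : ℂ) * v n‖ ^ (2 : ℝ) ≤ (c * ‖v‖) ^ (2 : ℝ) := by
    intro v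
    have h1 : HasSum (fun n => ‖v n‖ ^ (2 : ℝ)) (‖v‖ ^ (2 : ℝ)) := by
      simpa using lp.hasSum_norm (p := 2) (by norm_num) v
    have h2 := h1.mul_left (c ^ (2 : ℝ))
    have hle : ∀ n, ‖(d n : ℂ) * v n‖ ^ (2 : ℝ) ≤ c ^ (2 : ℝ) * ‖v n‖ ^ (2 : ℝ) := by
      intro n
      rw [← Real.mul_rpow hc (norm_nonneg _), norm_mul, Complex.norm_real]
      exact Real.rpow_le_rpow (by positivity)
        (mul_le_mul_of_nonneg_right (hd n) (norm_nonneg _)) (by norm_num)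
    have h3 : Summable fun n => ‖(d n : ℂ) * v n‖ ^ (2 : ℝ) :=
      Summable.of_nonneg_of_le (fun _ => by positivity) hle h2.summable
    refine ⟨h3.hasSum, ?_⟩
    rw [Real.mul_rpow hc (norm_nonneg _)]
    exact hasSum_le hle h3.hasSum h2
  have hnorm : ∀ v : lp (fun _ : ℕ+ => ℂ) 2,
      HasSum (fun k => ‖E v k‖ ^ (2 : ℝ)) (∑' n, ‖(d n : ℂ) * v n‖ ^ (2 : ℝ)) := by
    intro v
    refine (hφ.hasSum_iff fun k hk => ?_).1 ((hsum v).1.of_eq (fun n => ?_) rfl)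
    · rw [hE0 v k hk]; simp
    · simp only [Function.comp, hEφ]
  have hmem : ∀ v : lp (fun _ : ℕ+ => ℂ) 2, Memℓp (E v) 2 := by
    intro v
    rw [memℓp_gen_iff (by norm_num)]
    simpa using (hnorm v).summable
  have hsplit : ∀ (P : ℕ+ → Prop), (∀ n, P (φ n)) → (∀ k, (¬∃ n, φ n = k) → P k) → ∀ k, P k := by
    intro P h1 h2 k
    by_cases h : ∃ n, φ n = k
    · obtain ⟨n, rfl⟩ := h; exact h1 n
    · exact h2 k h
  let L : lp (fun _ : ℕ+ => ℂ) 2 →ₗ[ℂ] lp (fun _ : ℕ+ => ℂ) 2 :=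
    { toFun := fun v => ⟨E v, hmem v⟩
      map_add' := fun v w => by
        ext k
        change E (v + w : lp (fun _ : ℕ+ => ℂ) 2) k = E v k + E w k
        refine hsplit (fun k => E (v + w : lp (fun _ : ℕ+ => ℂ) 2) k = E v k + E w k)
          (fun n => ?_) (fun k hk => ?_) k
        · simp only [hEφ, lp.coeFn_add, Pi.add_apply, mul_add]
        · simp only [hE0 _ k hk, add_zero]
      map_smul' := fun a v => by
        ext k
        change E (a • v : lp (fun _ : ℕ+ => ℂ) 2) k = a * E v k
        refine hsplit (fun k => E (a • v : lp (fun _ : ℕ+ => ℂ) 2) k = a * E v k)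
          (fun n => ?_) (fun k hk => ?_) k
        · simp only [hEφ, lp.coeFn_smul, Pi.smul_apply, smul_eq_mul]; ring
        · simp only [hE0 _ k hk, mul_zero] }
  have hL : ∀ v, ‖L v‖ ≤ c * ‖v‖ := by
    intro v
    have h1 : HasSum (fun k => ‖E v k‖ ^ (2 : ℝ)) (‖L v‖ ^ (2 : ℝ)) := by
      have := lp.hasSum_norm (p := 2) (by norm_num) (L v)
      rw [ENNReal.toReal_ofNat] at this
      exact this
    have h2 := (h1.unique (hnorm v)).trans_le (hsum v).2
    exact (Real.rpow_le_rpow_iff (norm_nonneg _) (by positivity) (by norm_num)).1 h2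
  refine ⟨L.mkContinuous c hL, L.mkContinuous_norm_le hc hL, fun n => ?_⟩
  ext k
  change E (Pi.single n 1) k = (d n : ℂ) * (Pi.single (φ n) (1 : ℂ) : ℕ+ → ℂ) k
  refine hsplit (fun k => E (Pi.single n 1) k = (d n : ℂ) * (Pi.single (φ n) (1 : ℂ) : ℕ+ → ℂ) k)
    (fun m => ?_) (fun k hk => ?_) k
  · rw [hEφ]
    by_cases h : m = n
    · subst h; simp
    · rw [Pi.single_eq_of_ne h, Pi.single_eq_of_ne (fun h' => h (hφ h')), mul_zero, mul_zero]
  · rw [hE0 _ k hk, Pi.single_eq_of_ne (fun h => hk ⟨n, h.symm⟩), mul_zero]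

/-- A Neumann series argument: a series of operators whose norms sum to less than one is a
perturbation of the identity that keeps it invertible. -/
theorem exists_equiv_of_tsum_lt_one {X : Type*} [NormedAddCommGroup X] [NormedSpace ℂ X]
    [CompleteSpace X] {B : ℕ → X →L[ℂ] X} {c : ℕ → ℝ} (hB : ∀ l, ‖B l‖ ≤ c l) (hc : Summable c)
    (hc1 : ∑' l, c l < 1) : ∃ T : X ≃L[ℂ] X, ∀ v, HasSum (fun l => B l v) (T v - v) := by
  have hBs : Summable B := Summable.of_norm_bounded hc hB
  have hA1 : ‖-∑' l, B l‖ < 1 := by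
    rw [norm_neg]
    exact (tsum_of_norm_bounded hc.hasSum hB).trans_lt hc1
  refine ⟨ContinuousLinearEquiv.unitsEquiv ℂ X (Units.oneSub (-∑' l, B l) hA1), fun v => ?_⟩
  have h1 : HasSum (fun l => B l v) ((∑' l, B l) v) :=
    (ContinuousLinearMap.apply ℂ X v).hasSum hBs.hasSum
  refine h1.of_eq (fun _ => rfl) ?_
  rw [ContinuousLinearEquiv.unitsEquiv_apply, Units.val_oneSub, sub_neg_eq_add]
  simp

/-- The operator `eₙ ↦ ∑ₗ d l n • e₍₂ₗ₊₁₎ₙ` on `ℓ²` is invertible when its part with `l ≥ 1` is small. -/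
theorem exists_harmonic_equiv {d : ℕ → ℕ+ → ℝ} {c : ℕ → ℝ} (hd : ∀ l n, |d l n| ≤ c l)
    (hd0 : ∀ n, d 0 n = 1) (hc : Summable c) (hc1 : ∑' l, c (l + 1) < 1) :
    ∃ T : lp (fun _ : ℕ+ => ℂ) 2 ≃L[ℂ] lp (fun _ : ℕ+ => ℂ) 2, ∀ n,
      HasSum (fun l => (d l n : ℂ) • lp.single 2 (oddPNat l * n) (1 : ℂ)) (T (lp.single 2 n 1)) := by
  choose B hB1 hB2 using fun l => exists_weighted_shift
    (φ := fun n => oddPNat l * n) (fun _ _ h => mul_left_cancel h) (hd l)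
  obtain ⟨T, hT⟩ := exists_equiv_of_tsum_lt_one (fun l => hB1 (l + 1))
    ((summable_nat_add_iff 1).2 hc) hc1
  refine ⟨T, fun n => ?_⟩
  set g : ℕ → lp (fun _ : ℕ+ => ℂ) 2 := fun l => B l (lp.single 2 n 1) with hg
  have h1 : HasSum g (T (lp.single 2 n 1) - lp.single 2 n 1 + ∑ l ∈ Finset.range 1, g l) :=
    (hasSum_nat_add_iff 1).1 (hT (lp.single 2 n 1))
  have h0 : g 0 = lp.single 2 n 1 := by
    rw [hg]
    dsimp only
    rw [hB2, hd0, oddPNat_zero, one_mul, Complex.ofReal_one, one_smul]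
  rw [Finset.sum_range_one, h0, sub_add_cancel] at h1
  exact h1.of_eq (fun l => (hB2 l n).symm) rfl

/-- A linear isomorphism onto `ℓ²` and nonzero scalars give an unconditional basis. -/
theorem exists_unconditionalSchauderBasis {X : Type*} [NormedAddCommGroup X] [NormedSpace ℂ X]
    (Φ : X ≃L[ℂ] lp (fun _ : ℕ+ => ℂ) 2) {a : ℕ+ → ℂ} (ha : ∀ n, a n ≠ 0) :
    ∃ b : UnconditionalSchauderBasis ℕ+ ℂ X, ∀ n, b n = Φ.symm (a n • lp.single 2 n 1) := by
  refine ⟨⟨fun n => Φ.symm (a n • lp.single 2 n 1),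
    fun n => (a n)⁻¹ • (lp.evalCLM ℂ (fun _ : ℕ+ => ℂ) 2 n).comp
      (Φ : X →L[ℂ] lp (fun _ : ℕ+ => ℂ) 2), fun i j => ?_, fun x => ?_⟩, fun n => rfl⟩
  · change (a i)⁻¹ * (Φ (Φ.symm (a j • lp.single 2 j 1))) i = _
    rw [ContinuousLinearEquiv.apply_symm_apply, lp.coeFn_smul, Pi.smul_apply, smul_eq_mul,
      lp.single_apply]
    by_cases h : i = j
    · subst h; simp [ha]
    · simp [h]
  · have h := (Φ.symm : lp (fun _ : ℕ+ => ℂ) 2 →L[ℂ] X).hasSum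
      (lp.hasSum_single (p := 2) (by norm_num) (Φ x))
    refine h.of_eq (fun n => ?_) (Φ.symm_apply_apply x).symm
    change ((a n)⁻¹ * (Φ x) n) • Φ.symm (a n • lp.single 2 n 1) = Φ.symm (lp.single 2 n ((Φ x) n))
    rw [← map_smul, smul_smul, mul_right_comm, inv_mul_cancel₀ (ha n), one_mul, ← lp.single_smul,
      smul_eq_mul, mul_one]

/-! ### The basis property -/

theorem sineCoeff_sub (f g : L2I) (n : ℕ+) :
    sineCoeff (f - g) n = sineCoeff f n - sineCoeff g n := by
  rw [sub_eq_add_neg, ← neg_one_smul ℂ g, sineCoeff_add, sineCoeff_smul]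
  ring

/-- The weighted sine coefficients of an eigenfunction, as a perturbation of a multiple of the
`n`-th unit vector. -/
theorem exists_eigenfunction_coeff (α : ℝ) {μ : ℝ} (hμ : μ ∈ Ioo (0 : ℝ) 1) (n : ℕ+) :
    IsEigenfunction (eigenvalue n μ) (eigenfunction n μ) ∧
    ∃ a : ℝ, a ≠ 0 ∧ ∃ F : L2I,
      F =ᵐ[volume.restrict (Ioo (0 : ℝ) 1)] (fun x => (eigenfunction n μ x : ℂ)) ∧
      ∀ k : ℕ+, HasSum (fun l : ℕ => (a : ℂ) *
        ((((2 * (l : ℝ) + 1) ^ α * harmonicRatio (nome μ) l : ℝ) : ℂ) *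
          (Pi.single (oddPNat l * n) (1 : ℂ) : ℕ+ → ℂ) k))
        ((((k : ℝ) ^ α : ℝ) : ℂ) * sineCoeff F k) := by
  obtain ⟨θ, hθ, hnome, h⟩ := exists_eigenfunction_eq hμ
  obtain ⟨C, hC, heq, heig⟩ := h n
  have hnm := nome_mem hμ
  have hn : (0 : ℝ) < n := by exact_mod_cast n.pos
  have hcont : Continuous (eigenfunction n μ) := by
    have := continuous_jacobiSeries hθ
    rw [funext heq]
    fun_prop
  set κ := 2 * Real.exp (-θ) / (1 - nome μ) with hκ
  have hκ0 : κ ≠ 0 := by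
    have := sub_pos.2 hnm.2
    positivity
  refine ⟨heig, √2 * C * κ * (n : ℝ) ^ α,
    mul_ne_zero (mul_ne_zero (mul_ne_zero (by positivity) hC) hκ0) (by positivity),
    (memLp_ofReal_of_continuous hcont).toLp _, MemLp.coeFn_toLp _, fun k => ?_⟩
  have h1 := ((hasSum_integral_jacobiSeries hθ n k).mul_left ((k : ℝ) ^ α * (√2 * C)))
  have h2 : (k : ℝ) ^ α * (√2 * C) *
      ∫ x in (0 : ℝ)..1, jacobiSeries θ (n * Real.pi * x) * Real.sin (k * Real.pi * x) =
      (k : ℝ) ^ α * (√2 * ∫ x in (0 : ℝ)..1, eigenfunction n μ x * Real.sin (k * Real.pi * x)) := by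
    simp only [heq, mul_assoc, intervalIntegral.integral_const_mul]
  rw [h2] at h1
  rw [sineCoeff_toLp hcont, ← Complex.ofReal_mul]
  refine (Complex.hasSum_ofReal.2 h1).of_eq (fun l => ?_) rfl
  rw [cschOdd_eq hθ hnome, ← hκ]
  by_cases hk : oddPNat l * n = k
  · have h3 : (k : ℝ) ^ α = (2 * (l : ℝ) + 1) ^ α * (n : ℝ) ^ α := by
      rw [← Real.mul_rpow (by positivity) hn.le, ← hk]
      push_cast [PNat.mul_coe, oddPNat_coe]
      rfl
    rw [if_pos hk, h3, hk, Pi.single_eq_same]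
    push_cast; ring
  · rw [if_neg hk, Pi.single_eq_of_ne (Ne.symm hk)]
    simp

/-- The harmonics beyond the first one have total weight less than one when the nomes stay below
the threshold. -/
theorem exists_weight_bound {α r : ℝ} {q : ℕ+ → ℝ} (hr : r ∈ Ioo (0 : ℝ) 1) (hr2 : sFun α r = 2)
    (hq : q ∈ admissibleNomes r) : ∃ c : ℕ → ℝ, Summable c ∧ ∑' l, c (l + 1) < 1 ∧
      ∀ (l : ℕ) n, |(2 * (l : ℝ) + 1) ^ α * harmonicRatio (q n) l| ≤ c l := by
  obtain ⟨hq01, hqr⟩ := hq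
  have hbdd : BddAbove (range q) := ⟨1, by rintro _ ⟨n, rfl⟩; exact (hq01 n).2.le⟩
  set Q := ⨆ n, q n with hQ
  have hle : ∀ n, q n ≤ Q := fun n => le_ciSup hbdd n
  have hQ01 : Q ∈ Ioo (0 : ℝ) 1 := ⟨(hq01 1).1.trans_le (hle 1), hqr.trans hr.2⟩
  have hs := hasSum_sFun (α := α) hQ01.1.le hQ01.2
  refine ⟨_, hs.summable, ?_, fun l n => ?_⟩
  · have h1 := hs.summable.tsum_eq_zero_add
    have h2 := strictMonoOn_sFun α hQ01 hr hqr
    rw [hs.tsum_eq, harmonicRatio_zero_right hQ01.2] at h1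
    simp only [Nat.cast_zero, mul_zero, zero_add, Real.one_rpow, mul_one] at h1
    linarith
  · have h := harmonicRatio_nonneg (hq01 n).1.le (hq01 n).2 l
    rw [abs_of_nonneg (mul_nonneg (by positivity) h)]
    exact mul_le_mul_of_nonneg_left (harmonicRatio_mono (hq01 n).1 (hle n) hQ01.2 l) (by positivity)

theorem exists_eigenfunction_basis {α r : ℝ} (hα : 0 ≤ α) (hr : r ∈ Ioo (0 : ℝ) 1)
    (hr2 : sFun α r = 2) {q μ : ℕ+ → ℝ} (hq : q ∈ admissibleNomes r)
    (hμ : ∀ n, μ n ∈ Ioo 0 1 ∧ nome (μ n) = q n) :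
    ∃ b : UnconditionalSchauderBasis ℕ+ ℂ (SobolevH α),
      ∀ n, (b n).toL2 =ᵐ[volume.restrict (Ioo (0 : ℝ) 1)]
        fun x => (eigenfunction n (μ n) x : ℂ) := by
  choose a ha F hF hcoeff using fun n => (exists_eigenfunction_coeff α (hμ n).1 n).2
  obtain ⟨c, hc, hc1, hcle⟩ := exists_weight_bound hr hr2 hq
  obtain ⟨T, hT⟩ := exists_harmonic_equiv
    (d := fun l n => (2 * (l : ℝ) + 1) ^ α * harmonicRatio (q n) l) hcle
    (fun n => by simp [harmonicRatio_zero_right (hq.1 n).2]) hc hc1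
  set J := (SobolevH.equivEll2 hα).toContinuousLinearEquiv with hJ
  obtain ⟨b, hb⟩ := exists_unconditionalSchauderBasis (J.trans T.symm)
    (a := fun n => (a n : ℂ)) (fun n => Complex.ofReal_ne_zero.2 (ha n))
  refine ⟨b, fun n => ?_⟩
  suffices h : (b n).toL2 = F n by rw [h]; exact hF n
  refine sub_eq_zero.1 (eq_zero_of_sineCoeff_eq_zero _ fun k => ?_)
  rw [sineCoeff_sub, sub_eq_zero]
  have hk : (((k : ℝ) ^ α : ℝ) : ℂ) ≠ 0 := by
    have : (0 : ℝ) < k := by exact_mod_cast k.pos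
    exact Complex.ofReal_ne_zero.2 (by positivity)
  refine mul_left_cancel₀ hk ?_
  have h1 : SobolevH.toEll2 α (b n) = (a n : ℂ) • T (lp.single 2 n 1) := by
    rw [← map_smul, hb]
    exact J.apply_symm_apply _
  rw [← SobolevH.toEll2_apply, h1]
  have h2 := (lp.evalCLM ℂ (fun _ : ℕ+ => ℂ) 2 k).hasSum (hT n)
  refine (h2.mul_left (a n : ℂ)).unique ((hcoeff n k).of_eq (fun l => ?_) rfl)
  rw [(hμ n).2]
  rfl

end GrossPitaevskii

end

open GrossPitaevskii in
theorem theorem4p1 (α : ℝ) (hα : 0 ≤ α) :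
    (∃! r : ℝ, r ∈ Set.Ioo 0 1 ∧ sFun α r = 2) ∧
    ∀ r₀ ∈ Set.Ioo (0 : ℝ) 1, sFun α r₀ = 2 →
      ∀ q ∈ admissibleNomes r₀,
        ∀ μ : ℕ+ → ℝ, (∀ n, μ n ∈ Set.Ioo 0 1 ∧ nome (μ n) = q n) →
          (∀ n, IsEigenfunction (eigenvalue n (μ n)) (eigenfunction n (μ n))) ∧
          ∃ b : UnconditionalSchauderBasis ℕ+ ℂ (SobolevH α),
            ∀ n, (b n).toL2 =ᵐ[MeasureTheory.volume.restrict (Set.Ioo (0 : ℝ) 1)]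
              fun x => (eigenfunction n (μ n) x : ℂ) :=
  ⟨existsUnique_sFun_eq_two hα, fun _ hr hr2 _ hq _ hμ =>
    ⟨fun n => (exists_eigenfunction_coeff α (hμ n).1 n).1,
      exists_eigenfunction_basis hα hr hr2 hq hμ⟩⟩
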